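/- Let $n\ge 1$, equip $\mathbb R^{n+1}$ with its flat connection $\hat\nabla$ and a nonzero constant volume form $\Psi=c\,dx^1\wedge\dots\wedge dx^{n+1}$, and let $F$ be a $C^\infty$ function on an open set $D\subset\mathbb R^{n+1}$. Write $F_i$ and $F_{ij}$ for the components of $dF$ and of the Hessian of $F$, and put $$H(F)=c^{-2}\det(F_{ij}),\quad U^{ij}=c^{-2}\,\mathrm{adj}(F_{ij}),\quad N^i=U^{ip}F_p,\quad U(F)=N^iF_i .$$ Let $\Omega$ be a connected component of $\{x\in D: U(F)(x)\neq 0\}$, and for $r\in F(\Omega)$ let $L_r=\{x\in\Omega: F(x)=r\}$. On $\Omega$ define the one-forms $$\mu=\tfrac1{n+2}\,d\log|U(F)|,\qquad \rho=-|U(F)|^{-1/(n+2)}\,dF$$ ($\rho$ is the equiaffine conormal). Let $m_{ij}=F_{ij}-U(F)^{-1}H(F)F_iF_j+U(F)^{-1}F_iF_j$ (which is invertible on $\Omega$), with inverse $m^{ij}$, let $\Pi^{ij}=m^{ij}-U(F)^{-1}N^iN^j$, let $Z^i=U(F)\,\Pi^{ip}\mu_p$, and define the equiaffine normal vector field of the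 level sets of $F$ by $$\nu=-\operatorname{sign}(U(F))\,|U(F)|^{-(n+1)/(n+2)}\,(N+Z).$$ The equiaffine mean curvature $\mathcal A$ of $L_r$ is $n^{-1}\operatorname{tr}S$, where the endomorphism $S$ of the tangent spaces of $L_r$ is determined by $\hat\nabla_X\nu=-S(X)+\tau(X)\nu$ for $X$ tangent to $L_r$. The following are equivalent: 1. $U(F)$ is locally constant on $L_r$ for every $r\in F(\Omega)$. 2. $d\rho=0$ on $\Omega$. 3. $\mu\wedge\rho=0$ on $\Omega$. 4. The local flow of $\nu$ on $\Omega$ preserves the level sets of $F$: whenever $\varphi_t:V\to\Omega$ ($V\subset\Omega$ open, $|t|<\varepsilon$) is a local flow of $\nu$ and $C\subset V$ is a connected subset of a level set $L_r$, the image $\varphi_t(C)$ lies in a level set $L_s$. 5. $\rho$ is constant along the local flow of $\nu$: $\varphi_t^*\rho=\rho$ on $V$ for every such local flow and every $|t|<\varepsilon$. 6. $\nu\wedge N=0$ on $\Omega$. 7. $\nu=-\operatorname{sign}(U(F))\,|U(F)|^{-(n+1)/(n+2)}\,N$ on $\Omega$. If these conditions hold, then: 8. At every point of $\Omega$, the equiaffine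 mean curvature $\mathcal A$ of the level set through that point satisfies $$n\mathcal A=(n+2)\operatorname{sign}(U(F))\,|U(F)|^{-(n+1)/(n+2)}\bigl(H(F)-N^p\mu_p\bigr).$$ 9. If $\Omega$ is simply connected, there is $G\in C^\infty(\Omega)$ with $dG=-\rho$; every such $G$ is locally constant on each level set $L_r$, $r\in F(\Omega)$, and satisfies $U(G)=\operatorname{sign}U(F)$, hence $|U(G)|=1$, on $\Omega$. -/

import Mathlib

namespace LevelSetAffine

/-- The affine space `ℝⁿ⁺¹` in its standard affine coordinates. Only its affine structure, its
topology and a parallel volume form are used below, never a metric. -/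
abbrev Space (n : ℕ) : Type := Fin (n + 1) → ℝ

/-- Parallel (that is, constant) top-degree forms `Ψ` on `ℝⁿ⁺¹`. -/
abbrev TopForm (n : ℕ) : Type := AlternatingMap ℝ (Space n) ℝ (Fin (n + 1))

noncomputable section

variable {n : ℕ}

/-- The `i`-th standard basis vector. -/
def stdVec (i : Fin (n + 1)) : Space n := Pi.single i 1

/-- The value `Ψ(e₁, …, eₙ₊₁)`, so that `Ψ = volCoeff Ψ · dx¹ ∧ ⋯ ∧ dxⁿ⁺¹`. -/
def volCoeff (Ψ : TopForm n) : ℝ := Ψ (fun i => stdVec i)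

/-- The components `F_i` of the differential. -/
def grad (F : Space n → ℝ) (x : Space n) : Space n := fun i => fderiv ℝ F x (stdVec i)

/-- The components `F_ij` of the Hessian. -/
def hess (F : Space n → ℝ) (x : Space n) : Matrix (Fin (n + 1)) (Fin (n + 1)) ℝ :=
  Matrix.of fun i j => fderiv ℝ (fun y => fderiv ℝ F y) x (stdVec i) (stdVec j)

/-- The Hessian determinant `H(F)`, defined by `det Hess F = H(F) Ψ²`. -/
def hessDet (Ψ : TopForm n) (F : Space n → ℝ) (x : Space n) : ℝ :=
  (hess F x).det / volCoeff Ψ ^ 2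

/-- The adjugate tensor `U^ij` of the Hessian, normalized by `Ψ⁻²`, so that
`U^ip F_pj = H(F) δ_j^i`. -/
def adjTensor (Ψ : TopForm n) (F : Space n → ℝ) (x : Space n) :
    Matrix (Fin (n + 1)) (Fin (n + 1)) ℝ :=
  (volCoeff Ψ ^ 2)⁻¹ • (hess F x).adjugate

/-- The vector field `N^i = U^ip F_p`. -/
def fieldN (Ψ : TopForm n) (F : Space n → ℝ) (x : Space n) : Space n :=
  (adjTensor Ψ F x).mulVec (grad F x)

/-- The function `U(F) = U^ij F_i F_j = N^i F_i`. -/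
def funU (Ψ : TopForm n) (F : Space n → ℝ) (x : Space n) : ℝ :=
  fieldN Ψ F x ⬝ᵥ grad F x

/-- The one-form `μ = (n + 2)⁻¹ d log |U(F)|` (`Real.log` is `log |·|`). -/
def formMu (Ψ : TopForm n) (F : Space n → ℝ) (x : Space n) : Space n →L[ℝ] ℝ :=
  ((n : ℝ) + 2)⁻¹ • fderiv ℝ (fun y => Real.log (funU Ψ F y)) x

/-- The equiaffine conormal one-form `ρ_i = -|U(F)|^{-1/(n+2)} F_i`. -/
def conormal (Ψ : TopForm n) (F : Space n → ℝ) (x : Space n) : Space n →L[ℝ] ℝ :=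
  (-(|funU Ψ F x| ^ (-(1 / ((n : ℝ) + 2))))) • fderiv ℝ F x

/-- The tensor `Π_ij = F_ij - U(F)⁻¹ H(F) F_i F_j`. -/
def secondLower (Ψ : TopForm n) (F : Space n → ℝ) (x : Space n) :
    Matrix (Fin (n + 1)) (Fin (n + 1)) ℝ :=
  hess F x - ((funU Ψ F x)⁻¹ * hessDet Ψ F x) • Matrix.vecMulVec (grad F x) (grad F x)

/-- The tensor `m_ij = Π_ij + q U(F)⁻¹ F_i F_j` with `q = 1`, nondegenerate where `U(F) ≠ 0`. -/
def metricM (Ψ : TopForm n) (F : Space n → ℝ) (x : Space n) :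
    Matrix (Fin (n + 1)) (Fin (n + 1)) ℝ :=
  secondLower Ψ F x + (funU Ψ F x)⁻¹ • Matrix.vecMulVec (grad F x) (grad F x)

/-- The tensor `Π^ij = m^ij - q⁻¹ U(F)⁻¹ N^i N^j` (with `q = 1`; it does not depend on `q`),
where `m^ij` is the inverse of `m_ij`. It annihilates `dF`, and its restriction to the level sets
of `F` is inverse to that of `Π_ij`. -/
def secondUpper (Ψ : TopForm n) (F : Space n → ℝ) (x : Space n) :
    Matrix (Fin (n + 1)) (Fin (n + 1)) ℝ :=
  (metricM Ψ F x)⁻¹ - (funU Ψ F x)⁻¹ • Matrix.vecMulVec (fieldN Ψ F x) (fieldN Ψ F x)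

/-- The vector field `Z^i = U(F) Π^ip μ_p`. -/
def fieldZ (Ψ : TopForm n) (F : Space n → ℝ) (x : Space n) : Space n :=
  funU Ψ F x • (secondUpper Ψ F x).mulVec (fun p => formMu Ψ F x (stdVec p))

/-- The equiaffine normal vector field
`W = -sign(U(F)) |U(F)|^{-(n+1)/(n+2)} (N + Z)` of the level sets of `F`. -/
def eqNormal (Ψ : TopForm n) (F : Space n → ℝ) (x : Space n) : Space n :=
  (-(Real.sign (funU Ψ F x) * |funU Ψ F x| ^ (-(((n : ℝ) + 1) / ((n : ℝ) + 2))))) •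
    (fieldN Ψ F x + fieldZ Ψ F x)

/-- The level set `{x ∈ Ω : F(x) = r}`. -/
def levelSet (F : Space n → ℝ) (Ω : Set (Space n)) (r : ℝ) : Set (Space n) :=
  {x | x ∈ Ω ∧ F x = r}

/-- The one-form `θ` is closed on `Ω`. -/
def IsClosedOn (θ : Space n → Space n →L[ℝ] ℝ) (Ω : Set (Space n)) : Prop :=
  ∀ x ∈ Ω, extDeriv (fun y => ContinuousAlternatingMap.ofSubsingleton ℝ (Space n) ℝ (0 : Fin 1)
    (θ y)) x = 0

/-- The wedge product of two covectors, as a bilinear function of two vectors, vanishes. -/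
def WedgeFormsZero (α β : Space n →L[ℝ] ℝ) : Prop :=
  ∀ u v : Space n, α u * β v - α v * β u = 0

/-- The bivector `v ∧ w`, with components `v^i w^j - v^j w^i`, vanishes. -/
def WedgeVectorsZero (v w : Space n) : Prop :=
  ∀ i j : Fin (n + 1), v i * w j - v j * w i = 0

/-- `φ` is a local flow in `Ω` of the vector field `X`, defined for times in `(-ε, ε)` and initial
points in the open set `V`: each `t ↦ φ t y` is the integral curve of `X` through `y`, and `φ` is
jointly continuously differentiable (for smooth `X` on an open `Ω` such local flows exist around
every point of `Ω`). -/
structure IsLocalFlow (X : Space n → Space n) (Ω V : Set (Space n)) (ε : ℝ)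
    (φ : ℝ → Space n → Space n) : Prop where
  isOpen : IsOpen V
  subset : V ⊆ Ω
  pos : 0 < ε
  mem : ∀ t ∈ Set.Ioo (-ε) ε, ∀ y ∈ V, φ t y ∈ Ω
  zero : ∀ y ∈ V, φ 0 y = y
  hasDerivAt : ∀ t ∈ Set.Ioo (-ε) ε, ∀ y ∈ V, HasDerivAt (fun s => φ s y) (X (φ t y)) t
  contDiffOn : ContDiffOn ℝ 1 (fun p : ℝ × Space n => φ p.1 p.2) (Set.Ioo (-ε) ε ×ˢ V)

/-- The local flow of `X` on `Ω` preserves the level sets of `F`: it carries every connected piece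
of a level set on which it is defined into a level set. -/
def FlowPreservesLevelSets (X : Space n → Space n) (F : Space n → ℝ) (Ω : Set (Space n)) : Prop :=
  ∀ (V : Set (Space n)) (ε : ℝ) (φ : ℝ → Space n → Space n), IsLocalFlow X Ω V ε φ →
    ∀ t ∈ Set.Ioo (-ε) ε, ∀ r : ℝ, ∀ C ⊆ V ∩ levelSet F Ω r, IsPreconnected C →
      ∃ s : ℝ, φ t '' C ⊆ levelSet F Ω s

/-- The one-form `θ` is constant along the local flow of `X` on `Ω`: `φ_t^* θ = θ`. -/
def FlowPreservesForm (X : Space n → Space n) (θ : Space n → Space n →L[ℝ] ℝ)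
    (Ω : Set (Space n)) : Prop :=
  ∀ (V : Set (Space n)) (ε : ℝ) (φ : ℝ → Space n → Space n), IsLocalFlow X Ω V ε φ →
    ∀ t ∈ Set.Ioo (-ε) ε, ∀ y ∈ V, (θ (φ t y)).comp (fderiv ℝ (φ t) y) = θ y

/-- The tangent space at `x` of the level set of `F` through the regular point `x`. -/
def tangent (F : Space n → ℝ) (x : Space n) : Submodule ℝ (Space n) :=
  LinearMap.ker (fderiv ℝ F x).toLinearMap

/-- The linear map `v ↦ -∇_v ξ + τ(v) ξ`, where `τ(v) = dF(∇_v ξ) / dF(ξ)`. -/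
def shapeAux (F : Space n → ℝ) (ξ : Space n → Space n) (x : Space n) :
    Space n →ₗ[ℝ] Space n :=
  -(fderiv ℝ ξ x).toLinearMap +
    ((fderiv ℝ F x (ξ x))⁻¹ •
      ((fderiv ℝ F x).toLinearMap.comp (fderiv ℝ ξ x).toLinearMap)).smulRight (ξ x)

theorem shapeAux_mem {F : Space n → ℝ} {ξ : Space n → Space n} {x : Space n}
    (h : fderiv ℝ F x (ξ x) ≠ 0) (v : Space n) : shapeAux F ξ x v ∈ tangent F x := by
  simp only [tangent, shapeAux, LinearMap.mem_ker]
  simp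
  field_simp
  ring

open Classical in
/-- The shape operator `S` of the level set of `F` through `x` with respect to the transversal `ξ`,
determined by `∇_X ξ = -S(X) + τ(X) ξ` for `X` tangent to the level set
(by convention `0` where `ξ` is not transverse). -/
def shapeOperator (F : Space n → ℝ) (ξ : Space n → Space n) (x : Space n) :
    tangent F x →ₗ[ℝ] tangent F x :=
  if h : fderiv ℝ F x (ξ x) ≠ 0 then
    ((shapeAux F ξ x).comp (tangent F x).subtype).codRestrict (tangent F x)
      (fun _ => shapeAux_mem h _)
  else 0

/-- The decomposition defining the shape operator, and its uniqueness. -/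
theorem shapeOperator_spec {F : Space n → ℝ} {ξ : Space n → Space n} {x : Space n}
    (h : fderiv ℝ F x (ξ x) ≠ 0) (v w : tangent F x) :
    (∃ τ : ℝ, fderiv ℝ ξ x (v : Space n) = -(w : Space n) + τ • ξ x) ↔
      w = shapeOperator F ξ x v := by
  have hw : fderiv ℝ F x (w : Space n) = 0 := w.2
  have key : ((shapeOperator F ξ x v : tangent F x) : Space n) = -(fderiv ℝ ξ x (v : Space n)) +
      ((fderiv ℝ F x (ξ x))⁻¹ * fderiv ℝ F x (fderiv ℝ ξ x (v : Space n))) • ξ x := by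
    simp [shapeOperator, h, shapeAux]
  constructor
  · rintro ⟨τ, hτ⟩
    apply Subtype.ext
    rw [key, hτ]
    have : (fderiv ℝ F x (ξ x))⁻¹ * fderiv ℝ F x (-(w : Space n) + τ • ξ x) = τ := by
      simp only [map_add, map_neg, map_smul, hw, smul_eq_mul]
      field_simp
      ring
    rw [this]
    abel
  · intro hv
    refine ⟨(fderiv ℝ F x (ξ x))⁻¹ * fderiv ℝ F x (fderiv ℝ ξ x (v : Space n)), ?_⟩
    rw [hv, key]
    abel

/-- The mean curvature `n⁻¹ tr S` at `x` of the level set of `F` through `x` with respect to the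
transversal `ξ`. -/
def meanCurvature (F : Space n → ℝ) (ξ : Space n → Space n) (x : Space n) : ℝ :=
  (n : ℝ)⁻¹ * LinearMap.trace ℝ (tangent F x) (shapeOperator F ξ x)

/-- The equiaffine mean curvature of the level set of `F` through `x`: the mean curvature with
respect to the equiaffine normal. -/
def eqMeanCurvature (Ψ : TopForm n) (F : Space n → ℝ) (x : Space n) : ℝ :=
  meanCurvature F (eqNormal Ψ F) x

end

end LevelSetAffine

open LevelSetAffine

/-! Everything reduces to one pointwise condition, $Z=0$, that is, $\mu$ is proportional to $dF$.
The tensor $m$ differs from the Hessian by a multiple of $dF\otimes dF$ chosen so that $\det m=c^2$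
and $mN=dF$. Hence $m^{-1}dF=N$, the field $Z$ is tangent to the level sets, and $Z=0$ exactly when
$\mu=U^{-1}\mu(N)\,dF$. This settles 3, 6 and 7; 2 joins them because $d\rho=-\mu\wedge\rho$, and 1
because it says that $dU$ kills $\ker dF$.

For the flow conditions, $\rho(\nu)=1$ and $dF(\nu)=-|U|^{1/(n+2)}$. If $\rho$ is closed, it is
locally $dG$ with $G$ growing at unit rate along the flow, so $\rho$ is preserved. If $\rho$ is
preserved, so is its kernel, hence the level sets. If level sets are preserved, differentiating
$F\circ\varphi_t$ at $t=0$ along a connected piece of $L_r$ shows that $|U|$ is constant there; this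
step needs local flows to exist (`exists_isLocalFlow`).

The mean curvature formula follows from
$\operatorname{tr}S=-\operatorname{div}\nu+dF(\hat\nabla_\nu\nu)/dF(\nu)$, with
$\operatorname{div}N=(n+1)H$ by Piola's identity. The potential $G$ comes from the Poincaré lemma.
Its Hessian is $|U|^{-1/(n+2)}$ times a rank-one change of $F_{ij}$ along $dF\otimes dF$, which does
not affect $dF^{T}\mathrm{adj}\,dF$, so $U(G)=|U|^{-1}U$. -/

namespace LevelSetAffine

open scoped Topology Matrix

/-! ### Density of invertible matrices and rank-one perturbations of the adjugate -/

section LinearAlgebra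

variable {ι : Type*} [Fintype ι] [DecidableEq ι]

/-- As a function of $t$ this is the characteristic polynomial of $-A$, with finitely many roots. It
lets polynomial identities pass from invertible to singular matrices, as is needed because the
Hessian may be degenerate. -/
theorem frequently_det_add_smul_one_ne_zero (A : Matrix ι ι ℝ) :
    ∃ᶠ t : ℝ in 𝓝 0, (A + t • (1 : Matrix ι ι ℝ)).det ≠ 0 := by
  have h1 : ∀ t : ℝ, (A + t • (1 : Matrix ι ι ℝ)).det = (-A).charpoly.eval t := by
    intro t
    rw [Matrix.eval_charpoly]
    congr 1
    rw [Matrix.scalar_apply, sub_neg_eq_add, add_comm, Matrix.smul_one_eq_diagonal]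
  have h2 : {t : ℝ | (-A).charpoly.eval t = 0}.Finite :=
    (Matrix.charpoly_monic (-A)).ne_zero |> fun h => by
      refine ((-A).charpoly.rootSet_finite ℝ).subset fun t ht => ?_
      rw [Polynomial.mem_rootSet]
      exact ⟨h, by simpa using ht⟩
  have h3 : ∀ᶠ t : ℝ in 𝓝[≠] 0, (A + t • (1 : Matrix ι ι ℝ)).det ≠ 0 := by
    have : ({t : ℝ | (-A).charpoly.eval t = 0} \ {0})ᶜ ∈ 𝓝 (0 : ℝ) :=
      (h2.subset Set.sdiff_subset).isClosed.isOpen_compl.mem_nhds (by simp)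
    filter_upwards [nhdsWithin_le_nhds this, self_mem_nhdsWithin] with t ht ht0
    rw [h1]
    intro h
    exact ht ⟨h, ht0⟩
  exact (h3.frequently).filter_mono nhdsWithin_le_nhds

theorem eq_of_eq_on_det_ne_zero {f g : Matrix ι ι ℝ → ℝ} (hf : Continuous f) (hg : Continuous g)
    (h : ∀ A : Matrix ι ι ℝ, A.det ≠ 0 → f A = g A) (A : Matrix ι ι ℝ) : f A = g A := by
  by_contra hne
  have hc : Continuous fun t : ℝ => A + t • (1 : Matrix ι ι ℝ) := by fun_prop
  have h0 : ∀ᶠ t : ℝ in 𝓝 0, f (A + t • 1) ≠ g (A + t • 1) := by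
    have hd : Continuous fun t : ℝ => f (A + t • 1) - g (A + t • 1) :=
      (hf.comp hc).sub (hg.comp hc)
    refine (hd.continuousAt.eventually_ne (y := 0) ?_).mono fun t ht => sub_ne_zero.1 ht
    simpa [sub_eq_zero] using hne
  obtain ⟨t, ht, ht'⟩ := ((frequently_det_add_smul_one_ne_zero A).and_eventually h0).exists
  exact ht' (h _ ht)

/-- The matrix determinant lemma in adjugate form: both sides are continuous in $A$, so the
invertible case suffices. -/
theorem det_add_smul_vecMulVec (A : Matrix ι ι ℝ) (s : ℝ) (u v : ι → ℝ) :
    (A + s • Matrix.vecMulVec u v).det = A.det + s * (v ⬝ᵥ A.adjugate *ᵥ u) := by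
  refine eq_of_eq_on_det_ne_zero (f := fun A => (A + s • Matrix.vecMulVec u v).det)
    (g := fun A => A.det + s * (v ⬝ᵥ A.adjugate *ᵥ u)) (by fun_prop) ?_ (fun B hB => ?_) A
  · refine Continuous.add (by fun_prop) (continuous_const.mul ?_)
    exact Continuous.dotProduct continuous_const
      (Continuous.matrix_mulVec (Continuous.matrix_adjugate continuous_id) continuous_const)
  · have hu : IsUnit B.det := isUnit_iff_ne_zero.2 hB
    have := Matrix.det_add_replicateCol_mul_replicateRow (ι := Unit) hu (s • u) v
    rw [← Matrix.smul_vecMulVec, Matrix.vecMulVec_eq Unit, this, Matrix.det_unique (n := Unit)]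
    simp only [Matrix.add_apply, Matrix.one_apply_eq, Matrix.mul_assoc]
    have h1 : (Matrix.replicateRow Unit v * (B⁻¹ * Matrix.replicateCol Unit (s • u))) default default
        = s * (v ⬝ᵥ B⁻¹ *ᵥ u) := by
      rw [← Matrix.replicateCol_mulVec, Matrix.replicateRow_mul_replicateCol_apply,
        Matrix.mulVec_smul, dotProduct_smul, smul_eq_mul]
    rw [h1, Matrix.inv_def, Ring.inverse_eq_inv', Matrix.smul_mulVec, dotProduct_smul, smul_eq_mul]
    field_simp

/-- The determinant is affine in the coefficient of $uv^{T}$, and this quantity is its slope.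
Comparing the coefficients $s$ and $s+1$ shows that the slope does not depend on $s$. -/
theorem dotProduct_adjugate_add_smul_vecMulVec (A : Matrix ι ι ℝ) (s : ℝ) (u v : ι → ℝ) :
    v ⬝ᵥ (A + s • Matrix.vecMulVec u v).adjugate *ᵥ u = v ⬝ᵥ A.adjugate *ᵥ u := by
  have h1 := det_add_smul_vecMulVec (A + s • Matrix.vecMulVec u v) 1 u v
  rw [add_assoc, ← add_smul, det_add_smul_vecMulVec, det_add_smul_vecMulVec] at h1
  linarith

theorem contDiffAt_det {E : Type*} [NormedAddCommGroup E] [NormedSpace ℝ E] {m : WithTop ℕ∞}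
    {A : E → Matrix ι ι ℝ} {x : E} (h : ∀ i j, ContDiffAt ℝ m (fun y => A y i j) x) :
    ContDiffAt ℝ m (fun y => (A y).det) x := by
  simp only [Matrix.det_apply]
  refine ContDiffAt.sum fun σ _ => ContDiffAt.const_smul _ ?_
  exact contDiffAt_prod fun i _ => h _ _

theorem contDiffAt_adjugate {E : Type*} [NormedAddCommGroup E] [NormedSpace ℝ E] {m : WithTop ℕ∞}
    {A : E → Matrix ι ι ℝ} {x : E} (h : ∀ i j, ContDiffAt ℝ m (fun y => A y i j) x) (i j : ι) :
    ContDiffAt ℝ m (fun y => (A y).adjugate i j) x := by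
  simp only [Matrix.adjugate_apply]
  refine contDiffAt_det fun k l => ?_
  simp only [Matrix.updateRow_apply]
  split_ifs
  · exact contDiffAt_const
  · exact h _ _

end LinearAlgebra

end LevelSetAffine

namespace LevelSetAffine

open scoped Topology Matrix

/-! ### Jacobi's formula and Piola's identity -/

section Piola

variable {ι : Type*} [Fintype ι] [DecidableEq ι]
variable {E : Type*} [NormedAddCommGroup E] [NormedSpace ℝ E]

theorem det_updateRow_eq_sum_adjugate (A : Matrix ι ι ℝ) (k : ι) (v : ι → ℝ) :
    (A.updateRow k v).det = ∑ l, A.adjugate l k * v l := by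
  rw [← Matrix.cramer_transpose_apply, Matrix.cramer_eq_adjugate_mulVec, Matrix.mulVec,
    dotProduct]
  simp [← Matrix.adjugate_transpose, Matrix.transpose_apply]

/-- Jacobi's formula for the derivative of a determinant. -/
theorem hasFDerivAt_det {A : E → Matrix ι ι ℝ} {A' : ι → ι → E →L[ℝ] ℝ} {x : E}
    (h : ∀ k l, HasFDerivAt (fun y => A y k l) (A' k l) x) :
    HasFDerivAt (fun y => (A y).det) (∑ k, ∑ l, (A x).adjugate l k • A' k l) x := by
  -- As a multilinear function of the rows, the determinant has as derivative the sum over rows of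
  -- determinants with one row replaced.
  let f : ContinuousMultilinearMap ℝ (fun _ : ι => ι → ℝ) ℝ :=
    { (Matrix.detRowAlternating (R := ℝ) (n := ι)).toMultilinearMap with
      cont := (Continuous.matrix_det continuous_id : Continuous fun M : Matrix ι ι ℝ => M.det) }
  have hA : HasFDerivAt (fun y => fun k l => A y k l)
      (ContinuousLinearMap.pi fun k => ContinuousLinearMap.pi fun l => A' k l) x := by
    rw [hasFDerivAt_pi]
    intro k
    rw [hasFDerivAt_pi]
    exact fun l => h k l
  have hf := (f.hasFDerivAt (x := fun k l => A x k l)).comp x hA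
  refine hf.congr_fderiv ?_
  ext v
  simp only [ContinuousLinearMap.comp_apply, ContinuousMultilinearMap.linearDeriv_apply,
    ContinuousLinearMap.coe_pi', sum_apply, smul_apply,
    smul_eq_mul]
  refine Finset.sum_congr rfl fun k _ => ?_
  rw [← det_updateRow_eq_sum_adjugate (A x) k fun l => A' k l v]
  rfl

/-- Take the divergence of $\mathrm{adj}(A)A=\det(A)I$. By Jacobi's formula and the symmetry of the
derivatives, the derivative of $\det A$ cancels the terms that differentiate $A$; what remains is
$\operatorname{div}(\mathrm{adj}A)\cdot A=0$, and $A$ can be cancelled. -/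
theorem sum_fderiv_adjugate_eq_zero_of_det_ne_zero {A : E → Matrix ι ι ℝ} {x : E} {e : ι → E}
    (hA : ∀ k l, ContDiffAt ℝ 1 (fun y => A y k l) x)
    (hsymm : ∀ i k l, fderiv ℝ (fun y => A y k l) x (e i) = fderiv ℝ (fun y => A y k i) x (e l))
    (hdet : (A x).det ≠ 0) (j : ι) :
    ∑ i, fderiv ℝ (fun y => (A y).adjugate i j) x (e i) = 0 := by
  have hd : ∀ k l, HasFDerivAt (fun y => A y k l) (fderiv ℝ (fun y => A y k l) x) x :=
    fun k l => ((hA k l).differentiableAt one_ne_zero).hasFDerivAt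
  have ha : ∀ k l, HasFDerivAt (fun y => (A y).adjugate k l)
      (fderiv ℝ (fun y => (A y).adjugate k l) x) x :=
    fun k l => ((contDiffAt_adjugate hA k l).differentiableAt one_ne_zero).hasFDerivAt
  have key : ∀ i l, ∑ k, ((A x).adjugate i k * fderiv ℝ (fun y => A y k l) x (e i) +
      A x k l * fderiv ℝ (fun y => (A y).adjugate i k) x (e i)) =
      if i = l then ∑ k, ∑ m, (A x).adjugate m k * fderiv ℝ (fun y => A y k m) x (e i) else 0 := by
    intro i l
    have h1 : HasFDerivAt (fun y => ∑ k, (A y).adjugate i k * A y k l) _ x :=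
      HasFDerivAt.fun_sum fun k _ => (ha i k).mul (hd k l)
    have h2 : (fun y => ∑ k, (A y).adjugate i k * A y k l) =
        fun y => if i = l then (A y).det else 0 := by
      ext y
      have := congrFun (congrFun (Matrix.adjugate_mul (A y)) i) l
      rw [Matrix.mul_apply] at this
      rw [this, Matrix.smul_apply, Matrix.one_apply]
      split_ifs <;> simp
    have h3 : HasFDerivAt (fun y => if i = l then (A y).det else 0)
        (if i = l then (∑ k, ∑ m, (A x).adjugate m k • fderiv ℝ (fun y => A y k m) x) else 0)
        x := by
      split_ifs
      · exact hasFDerivAt_det hd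
      · exact hasFDerivAt_const _ _
    rw [h2] at h1
    have h4 := congrArg (fun L => L (e i)) (h1.unique h3)
    simp only [sum_apply, add_apply,
      smul_apply, smul_eq_mul] at h4
    rw [h4]
    split_ifs <;> simp
  have hz : (fun k => ∑ i, fderiv ℝ (fun y => (A y).adjugate i k) x (e i)) ᵥ* A x = 0 := by
    ext l
    have h5 := Finset.sum_congr (rfl : (Finset.univ : Finset ι) = Finset.univ)
      (fun i _ => key i l)
    simp only [Finset.sum_add_distrib, Finset.sum_ite_eq', Finset.mem_univ, if_true] at h5
    have h6 : ∑ k, ∑ m, (A x).adjugate m k * fderiv ℝ (fun y => A y k m) x (e l) =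
        ∑ i, ∑ k, (A x).adjugate i k * fderiv ℝ (fun y => A y k l) x (e i) := by
      rw [Finset.sum_comm]
      refine Finset.sum_congr rfl fun m _ => Finset.sum_congr rfl fun k _ => ?_
      rw [hsymm l k m]
    rw [h6] at h5
    have h7 := add_eq_left.1 h5
    rw [Matrix.vecMul, dotProduct, Pi.zero_apply, ← h7, Finset.sum_comm]
    refine Finset.sum_congr rfl fun k _ => ?_
    rw [Finset.sum_mul]
    exact Finset.sum_congr rfl fun i _ => mul_comm _ _
  have := Matrix.eq_zero_of_vecMul_eq_zero hdet hz
  exact congrFun this j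

/-- Piola's identity: the adjugate of a Hessian-like matrix field is divergence free. -/
theorem sum_fderiv_adjugate_eq_zero {A : E → Matrix ι ι ℝ} {x : E} {e : ι → E}
    (hA : ∀ k l, ContDiffAt ℝ 1 (fun y => A y k l) x)
    (hsymm : ∀ i k l, fderiv ℝ (fun y => A y k l) x (e i) = fderiv ℝ (fun y => A y k i) x (e l))
    (j : ι) :
    ∑ i, fderiv ℝ (fun y => (A y).adjugate i j) x (e i) = 0 := by
  -- Perturbing $A$ to $A+tI$ keeps its derivatives in $x$. The divergence is continuous in $t$ and
  -- vanishes whenever $A(x)+tI$ is invertible, which happens arbitrarily close to $t=0$.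
  let g : ι → ℝ × E → ℝ := fun i p => (A p.2 + p.1 • (1 : Matrix ι ι ℝ)).adjugate i j
  have hAt : ∀ t : ℝ, ∀ k l,
      ContDiffAt ℝ 1 (fun p : ℝ × E => (A p.2 + p.1 • (1 : Matrix ι ι ℝ)) k l) (t, x) := by
    intro t k l
    simp only [Matrix.add_apply, Matrix.smul_apply, smul_eq_mul]
    exact ((hA k l).comp (t, x) contDiffAt_snd).add (contDiffAt_fst.mul contDiffAt_const)
  have hg : ∀ t i, ContDiffAt ℝ 1 (g i) (t, x) := fun t i => contDiffAt_adjugate (hAt t) i j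
  have hslice : ∀ t i, fderiv ℝ (fun y => (A y + t • (1 : Matrix ι ι ℝ)).adjugate i j) x (e i) =
      fderiv ℝ (g i) (t, x) (0, e i) := by
    intro t i
    have h1 := (((hg t i).differentiableAt one_ne_zero).hasFDerivAt).comp x
      (hasFDerivAt_prodMk_right t x)
    rw [show (fun y => (A y + t • (1 : Matrix ι ι ℝ)).adjugate i j) = g i ∘ fun y => (t, y) from rfl,
      h1.fderiv]
    simp
  have hcont : ContinuousAt (fun t : ℝ => ∑ i, fderiv ℝ (g i) (t, x) (0, e i)) 0 := by
    refine tendsto_finsetSum _ fun i _ => ?_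
    have h1 : ContinuousAt (fderiv ℝ (g i)) (0, x) :=
      ((hg 0 i).fderiv_right (m := 0) (by norm_num)).continuousAt
    have h2 : ContinuousAt (fun t : ℝ => (t, x)) 0 := by fun_prop
    have h3 : ContinuousAt (fun t : ℝ => fderiv ℝ (g i) (t, x)) 0 :=
      ContinuousAt.comp (g := fderiv ℝ (g i)) h1 h2
    exact (h3.clm_apply continuousAt_const)
  have hzero : ∀ t : ℝ, (A x + t • (1 : Matrix ι ι ℝ)).det ≠ 0 →
      ∑ i, fderiv ℝ (g i) (t, x) (0, e i) = 0 := by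
    intro t ht
    simp only [← hslice]
    have hfd : ∀ k l, fderiv ℝ (fun y => (A y + t • (1 : Matrix ι ι ℝ)) k l) x =
        fderiv ℝ (fun y => A y k l) x := by
      intro k l
      simp only [Matrix.add_apply]
      rw [fderiv_add_const]
    refine sum_fderiv_adjugate_eq_zero_of_det_ne_zero (A := fun y => A y + t • 1)
      (fun k l => (hA k l).add contDiffAt_const) (fun i k l => ?_) ht j
    rw [hfd, hfd, hsymm]
  by_contra hne
  have h0 : ∑ i, fderiv ℝ (g i) ((0 : ℝ), x) (0, e i) ≠ 0 := by
    simp only [← hslice]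
    simpa using hne
  obtain ⟨t, ht, ht'⟩ := ((frequently_det_add_smul_one_ne_zero (A x)).and_eventually
    (hcont.eventually_ne h0)).exists
  exact ht' (hzero t ht)

end Piola

end LevelSetAffine

namespace LevelSetAffine

open scoped Topology Matrix

/-! ### Superposition operators on spaces of continuous functions -/

section Superposition

variable {K : Type*} [TopologicalSpace K] [CompactSpace K]
variable {E : Type*} [NormedAddCommGroup E] [NormedSpace ℝ E]

/-- Pointwise application of a continuous family of operators to a continuous function. -/
noncomputable def pointwiseApply : C(K, E →L[ℝ] E) →L[ℝ] C(K, E) →L[ℝ] C(K, E) :=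
  LinearMap.mkContinuous₂
    (LinearMap.mk₂ ℝ (fun (A : C(K, E →L[ℝ] E)) (h : C(K, E)) => (⟨fun s => A s (h s), by fun_prop⟩ : C(K, E)))
      (fun _ _ _ => by ext; simp) (fun _ _ _ => by ext; simp)
      (fun _ _ _ => by ext; simp) (fun _ _ _ => by ext; simp)) 1
    (fun A h => by
      rw [ContinuousMap.norm_le _ (by positivity)]
      intro s
      rw [one_mul]
      exact (A s).le_of_opNorm_le_of_le (A.norm_coe_le_norm s) (h.norm_coe_le_norm s))

@[simp] theorem pointwiseApply_apply (A : C(K, E →L[ℝ] E)) (h : C(K, E)) (s : K) :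
    pointwiseApply A h s = A s (h s) := rfl

/-- The superposition operator of a `C¹` map is `C¹` on continuous functions. -/
theorem contDiff_comp_left {X : E → E} (hX : ContDiff ℝ 1 X) :
    ContDiff ℝ 1 (fun u : C(K, E) => (⟨X, hX.continuous⟩ : C(E, E)).comp u) := by
  have hc : Continuous (fderiv ℝ X) := hX.continuous_fderiv one_ne_zero
  let D : C(K, E) → C(K, E →L[ℝ] E) := fun u => (⟨fderiv ℝ X, hc⟩ : C(E, E →L[ℝ] E)).comp u
  have hD : Continuous D := ContinuousMap.continuous_postcomp _
  rw [contDiff_one_iff_hasFDerivAt]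
  refine ⟨fun u => pointwiseApply (D u), pointwiseApply.continuous.comp hD, fun u => ?_⟩
  rw [hasFDerivAt_iff_isLittleO, Asymptotics.isLittleO_iff]
  intro c hc0
  have hev : ∀ᶠ v in 𝓝 u, D v ∈ Metric.ball (D u) c :=
    (hD.tendsto u).eventually (Metric.ball_mem_nhds (D u) hc0)
  obtain ⟨δ, hδ, hball⟩ := Metric.mem_nhds_iff.1 hev
  filter_upwards [Metric.ball_mem_nhds u hδ] with v hv
  rw [ContinuousMap.norm_le _ (by positivity)]
  intro s
  -- A point of the segment from $u(s)$ to $v(s)$ is the value at $s$ of a function on the segment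
  -- from $u$ to $v$. Continuity of `D` in the sup norm therefore gives a bound uniform in $s$.
  have hseg : ∀ z ∈ segment ℝ (u s) (v s), ‖fderiv ℝ X z - fderiv ℝ X (u s)‖ ≤ c := by
    intro z hz
    obtain ⟨θ, hθ, rfl⟩ := (segment_eq_image_lineMap ℝ (u s) (v s)) ▸ hz
    have hw : AffineMap.lineMap u v θ ∈ Metric.ball u δ :=
      (convex_ball u δ).segment_subset (Metric.mem_ball_self hδ) hv
        (segment_eq_image_lineMap ℝ u v ▸ ⟨θ, hθ, rfl⟩)
    have h1 : dist (D (AffineMap.lineMap u v θ)) (D u) < c := hball hw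
    have h2 := (ContinuousMap.dist_apply_le_dist (f := D (AffineMap.lineMap u v θ)) (g := D u)
      s).trans h1.le
    rw [dist_eq_norm] at h2
    simpa [D, AffineMap.lineMap_apply] using h2
  have h3 := Convex.norm_image_sub_le_of_norm_fderiv_le' (𝕜 := ℝ) (f := X)
    (φ := fderiv ℝ X (u s)) (fun z _ => (hX.differentiable one_ne_zero) z) hseg
    (convex_segment _ _) (left_mem_segment ℝ _ _) (right_mem_segment ℝ _ _)
  have h4 : ‖v s - u s‖ ≤ ‖v - u‖ := (v - u).norm_coe_le_norm s
  refine le_trans (le_of_eq ?_) (h3.trans (mul_le_mul_of_nonneg_left h4 hc0.le))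
  simp [D]

end Superposition

/-! ### Joint differentiability of flows through the implicit function theorem -/

section Flow

variable {E : Type*} [NormedAddCommGroup E] [NormedSpace ℝ E]

open unitInterval MeasureTheory

/-- The primitive vanishing at `0`, as an operator on continuous curves. -/
noncomputable def primitiveCLM : C(I, E) →L[ℝ] C(I, E) :=
  have hint : ∀ (u : C(I, E)) (a b : ℝ), IntervalIntegrable
      (fun q => u (Set.projIcc 0 1 zero_le_one q)) volume a b :=
    fun u a b => Continuous.intervalIntegrable (by fun_prop) _ _
  LinearMap.mkContinuous
    { toFun := fun u => (⟨fun s => ∫ q in (0 : ℝ)..s, u (Set.projIcc 0 1 zero_le_one q),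
        (intervalIntegral.continuous_primitive (hint u) 0).comp continuous_subtype_val⟩ : C(I, E))
      map_add' := fun u v => by
        ext s
        exact intervalIntegral.integral_add (hint u 0 s) (hint v 0 s)
      map_smul' := fun c u => by
        ext s
        exact intervalIntegral.integral_smul c _ } 1
    (fun u => by
      rw [ContinuousMap.norm_le _ (by positivity)]
      intro s
      have h := intervalIntegral.norm_integral_le_of_norm_le_const (a := 0) (b := s)
        (f := fun q => u (Set.projIcc 0 1 zero_le_one q)) (C := ‖u‖)
        (fun q _ => u.norm_coe_le_norm _)
      have hs : |(s : ℝ) - 0| ≤ 1 := by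
        rw [sub_zero, abs_of_nonneg s.2.1]
        exact s.2.2
      calc _ ≤ ‖u‖ * |(s : ℝ) - 0| := h
        _ ≤ ‖u‖ * 1 := by gcongr
        _ = 1 * ‖u‖ := by ring)

theorem primitiveCLM_apply (u : C(I, E)) (s : I) :
    primitiveCLM u s = ∫ q in (0 : ℝ)..s, u (Set.projIcc 0 1 zero_le_one q) := rfl

/-- A `C¹` vector field has, near each point, a jointly `C¹` local flow. -/
theorem exists_contDiffAt_flow [CompleteSpace E] {X : E → E} (hX : ContDiff ℝ 1 X) (x₀ : E) :
    ∃ φ : ℝ → E → E, ContDiffAt ℝ 1 (fun p : ℝ × E => φ p.1 p.2) (0, x₀) ∧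
      ∀ᶠ p : ℝ × E in 𝓝 (0, x₀), φ 0 p.2 = p.2 ∧
        HasDerivAt (fun s => φ s p.2) (X (φ p.1 p.2)) p.1 := by
  obtain ⟨ε, hε, a, r, L, M, hr, hpl⟩ := IsPicardLindelof.of_contDiffAt_one
    (hX.contDiffAt (x := x₀))
  obtain ⟨α, hα, hαc⟩ := (hpl 0).exists_forall_mem_closedBall_eq_hasDerivWithinAt_continuousOn
  simp only [zero_sub, zero_add] at hα hαc
  have hr' : (0 : ℝ) < r := hr
  have hflow : ∀ x ∈ Metric.ball x₀ r, ∀ t ∈ Set.Ioo (-ε) ε,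
      HasDerivAt (fun s => α (x, s)) (X (α (x, t))) t := fun x hx t ht =>
    ((hα x (Metric.ball_subset_closedBall hx)).2 t (Set.Ioo_subset_Icc_self ht)).hasDerivAt
      (Icc_mem_nhds ht.1 ht.2)
  let NX : C(I, E) → C(I, E) := fun u => (⟨X, hX.continuous⟩ : C(E, E)).comp u
  have hNX : ContDiff ℝ 1 NX := contDiff_comp_left hX
  let cst : E →L[ℝ] C(I, E) := ContinuousLinearMap.const ℝ I
  -- Zeros of `G` are the solutions of $u(s)=x+t\int_0^sX(u(q))\,dq$: integral curves from $x$ with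
  -- time rescaled to $[0,1]$, so that $t$ becomes a parameter. At $t=0$ the partial derivative in
  -- $u$ is the identity.
  let G : (ℝ × E) × C(I, E) → C(I, E) := fun v =>
    v.2 - cst v.1.2 - v.1.1 • primitiveCLM (NX v.2)
  have hG : ContDiff ℝ 1 G := by
    have h1 : ContDiff ℝ 1 fun v : (ℝ × E) × C(I, E) => primitiveCLM (NX v.2) :=
      primitiveCLM.contDiff.comp (hNX.comp contDiff_snd)
    have h2 : ContDiff ℝ 1 fun v : (ℝ × E) × C(I, E) => cst v.1.2 :=
      cst.contDiff.comp (contDiff_snd.comp contDiff_fst)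
    exact (contDiff_snd.sub h2).sub ((contDiff_fst.comp contDiff_fst).smul h1)
  let w : (ℝ × E) × C(I, E) := ((0, x₀), cst x₀)
  have hGw : G w = 0 := by simp [G, w]
  have hinv : (fderiv ℝ G w ∘L .inr ℝ (ℝ × E) C(I, E)).IsInvertible := by
    have h1 : HasFDerivAt (fun u : C(I, E) => G ((0, x₀), u))
        (fderiv ℝ G w ∘L .inr ℝ (ℝ × E) C(I, E)) (cst x₀) :=
      ((hG.differentiable one_ne_zero) w).hasFDerivAt.comp (cst x₀)
        (hasFDerivAt_prodMk_right (0, x₀) (cst x₀))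
    have h2 : HasFDerivAt (fun u : C(I, E) => G ((0, x₀), u))
        (ContinuousLinearMap.id ℝ C(I, E)) (cst x₀) := by
      have : (fun u : C(I, E) => G ((0, x₀), u)) = fun u => u - cst x₀ := by
        ext u : 1
        simp [G]
      rw [this]
      exact (hasFDerivAt_id _).sub_const _
    rw [h1.unique h2]
    exact ⟨ContinuousLinearEquiv.refl ℝ _, rfl⟩
  have hGat : ContDiffAt ℝ 1 G w := hG.contDiffAt
  let U := hGat.implicitFunction one_ne_zero hinv
  have hU : ContDiffAt ℝ 1 U (0, x₀) := hGat.contDiffAt_implicitFunction one_ne_zero hinv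
  have hiff := hGat.eventually_apply_eq_iff_implicitFunction one_ne_zero hinv
  classical
  -- The rescaled Picard–Lindelöf curve $s\mapsto\alpha(x,ts)$; the default value $0$ is never met
  -- for small $t$ and $x$ near $x_0$.
  let c : ℝ × E → C(I, E) := fun p =>
    if h : Continuous fun s : I => α (p.2, p.1 * s) then ⟨_, h⟩ else 0
  have hcc : ∀ p : ℝ × E, p.1 ∈ Set.Ioo (-ε) ε → p.2 ∈ Metric.ball x₀ r →
      ∀ s : I, c p s = α (p.2, p.1 * s) := by
    intro p hp1 hp2 s
    have hcont : Continuous fun s : I => α (p.2, p.1 * s) := by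
      refine hαc.comp_continuous (by fun_prop) fun s =>
        ⟨Metric.ball_subset_closedBall hp2, ?_⟩
      exact abs_le.1 (by
        rw [abs_mul, abs_of_nonneg s.2.1]
        exact (mul_le_of_le_one_right (abs_nonneg _) s.2.2).trans (abs_lt.2 hp1).le)
    simp only [c, dif_pos hcont, ContinuousMap.coe_mk]
  have hdom : ∀ᶠ p : ℝ × E in 𝓝 (0, x₀), p.1 ∈ Set.Ioo (-ε) ε ∧ p.2 ∈ Metric.ball x₀ r :=
    prod_mem_nhds (Ioo_mem_nhds (by linarith) hε) (Metric.ball_mem_nhds x₀ hr')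
  have hctend : Filter.Tendsto c (𝓝 (0, x₀)) (𝓝 (cst x₀)) := by
    rw [Metric.tendsto_nhds]
    intro η hη
    have hαat : ContinuousAt α (x₀, 0) := hαc.continuousAt
      (prod_mem_nhds (Metric.closedBall_mem_nhds x₀ hr') (Icc_mem_nhds (by linarith) hε))
    have hα0 : α (x₀, 0) = x₀ := (hα x₀ (Metric.mem_closedBall_self hr'.le)).1
    obtain ⟨δ, hδ, hαδ⟩ := Metric.continuousAt_iff.1 hαat η hη
    filter_upwards [hdom, Metric.ball_mem_nhds (0, x₀) hδ] with p hp hpδ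
    rw [ContinuousMap.dist_lt_iff hη]
    intro s
    rw [hcc p hp.1 hp.2 s]
    have := @hαδ (p.2, p.1 * s) (by
      rw [Metric.mem_ball, Prod.dist_eq, max_lt_iff] at hpδ
      rw [Prod.dist_eq, max_lt_iff]
      refine ⟨hpδ.2, lt_of_le_of_lt ?_ hpδ.1⟩
      simp only [dist_zero_right, norm_mul, Real.norm_eq_abs]
      rw [abs_of_nonneg s.2.1]
      exact mul_le_of_le_one_right (abs_nonneg _) s.2.2)
    rwa [hα0] at this
  have hGc : ∀ p : ℝ × E, p.1 ∈ Set.Ioo (-ε) ε → p.2 ∈ Metric.ball x₀ r → G (p, c p) = 0 := by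
    intro p hp1 hp2
    ext s
    have hmem : ∀ q ∈ Set.Icc (0 : ℝ) 1, p.1 * q ∈ Set.Ioo (-ε) ε := fun q hq => abs_lt.1 (by
      rw [abs_mul, abs_of_nonneg hq.1]
      exact (mul_le_of_le_one_right (abs_nonneg _) hq.2).trans_lt (abs_lt.2 hp1))
    have hsub : ∀ q ∈ Set.uIcc (0 : ℝ) s, q ∈ Set.Icc (0 : ℝ) 1 := fun q hq => by
      rw [Set.uIcc_of_le s.2.1] at hq
      exact ⟨hq.1, hq.2.trans s.2.2⟩
    have hder : ∀ q ∈ Set.uIcc (0 : ℝ) s, HasDerivAt (fun q : ℝ => α (p.2, p.1 * q))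
        (p.1 • NX (c p) (Set.projIcc 0 1 zero_le_one q)) q := by
      intro q hq
      have h1 := hflow p.2 hp2 _ (hmem q (hsub q hq))
      have h2 : HasDerivAt (fun q : ℝ => p.1 * q) p.1 q := by
        simpa using (hasDerivAt_id q).const_mul p.1
      have h3 := h1.scomp q h2
      simp only [NX, ContinuousMap.comp_apply, ContinuousMap.coe_mk]
      rw [hcc p hp1 hp2, Set.projIcc_of_mem zero_le_one (hsub q hq)]
      exact h3
    have hint := intervalIntegral.integral_eq_sub_of_hasDerivAt hder
      (Continuous.intervalIntegrable (by fun_prop) _ _)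
    rw [intervalIntegral.integral_smul, mul_zero,
      (hα p.2 (Metric.ball_subset_closedBall hp2)).1] at hint
    simp only [G, ContinuousMap.sub_apply, ContinuousMap.smul_apply, primitiveCLM_apply, hint,
      hcc p hp1 hp2, ContinuousMap.zero_apply]
    simp [cst]
  -- Near the base point all zeros of `G` lie on the graph of the $C^1$ implicit function. The
  -- curves `c p` are zeros tending to the constant curve, so they coincide with it; evaluation at
  -- $s=1$ then shows that the flow is $C^1$.
  have hUc : ∀ᶠ p : ℝ × E in 𝓝 (0, x₀), U p = c p := by
    have h1 : Filter.Tendsto (fun p => (p, c p)) (𝓝 (0, x₀)) (𝓝 w) := by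
      rw [nhds_prod_eq (x := ((0 : ℝ), x₀)) (y := cst x₀)]
      exact Filter.tendsto_id.prodMk hctend
    filter_upwards [h1.eventually hiff, hdom] with p hp hd
    exact hp.1 (by rw [hGc p hd.1 hd.2, hGw])
  refine ⟨fun t x => α (x, t), ?_, ?_⟩
  · have h1 : ContDiffAt ℝ 1 (ContinuousMap.evalCLM ℝ (1 : I) ∘ U) (0, x₀) :=
      (ContinuousMap.evalCLM (M := E) ℝ (1 : I)).contDiff.contDiffAt.comp _ hU
    refine h1.congr_of_eventuallyEq ?_
    filter_upwards [hUc, hdom] with p hp hd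
    rw [Function.comp_apply, hp, ContinuousMap.evalCLM_apply, hcc p hd.1 hd.2]
    simp
  · filter_upwards [hdom] with p hp
    exact ⟨(hα p.2 (Metric.ball_subset_closedBall hp.2)).1, hflow p.2 hp.2 p.1 hp.1⟩

end Flow

/-! ### Local flows of a vector field on an open set -/

section LocalFlow

variable {n : ℕ}

theorem exists_contDiff_eventuallyEq {X : Space n → Space n} {Ω : Set (Space n)} (hΩ : IsOpen Ω)
    (hX : ContDiffOn ℝ 1 X Ω) {x : Space n} (hx : x ∈ Ω) :
    ∃ Y : Space n → Space n, ContDiff ℝ 1 Y ∧ Y =ᶠ[𝓝 x] X := by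
  obtain ⟨R, hR, hball⟩ := Metric.isOpen_iff.1 hΩ x hx
  let b : ContDiffBump x := ⟨R / 4, R / 2, by positivity, by linarith⟩
  refine ⟨fun y => b y • X y, ?_, ?_⟩
  · rw [contDiff_iff_contDiffAt]
    intro y
    by_cases hy : y ∈ Metric.ball x R
    · exact b.contDiffAt.smul ((hX.contDiffAt (hΩ.mem_nhds (hball hy))))
    · have h0 : (fun y => b y • X y) =ᶠ[𝓝 y] fun _ => 0 := by
        have hmem : (Metric.closedBall x (R / 2))ᶜ ∈ 𝓝 y :=
          Metric.isClosed_closedBall.isOpen_compl.mem_nhds fun h =>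
            hy (Metric.closedBall_subset_ball (by linarith) h)
        filter_upwards [hmem] with z hz
        rw [b.zero_of_le_dist (le_of_lt (not_le.1 hz)), zero_smul]
      exact contDiffAt_const.congr_of_eventuallyEq h0
  · filter_upwards [b.eventuallyEq_one] with y hy
    simp [hy]

/-- A bump function extends the germ of `X` at `x` to a global $C^1$ field. For short times its flow
stays where the two fields agree. -/
theorem exists_isLocalFlow {X : Space n → Space n} {Ω : Set (Space n)} (hΩ : IsOpen Ω)
    (hX : ContDiffOn ℝ 1 X Ω) {x : Space n} (hx : x ∈ Ω) :
    ∃ (V : Set (Space n)) (ε : ℝ) (φ : ℝ → Space n → Space n), x ∈ V ∧ IsLocalFlow X Ω V ε φ := by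
  obtain ⟨Y, hY, hYX⟩ := exists_contDiff_eventuallyEq hΩ hX hx
  obtain ⟨φ, hφ, hev⟩ := exists_contDiffAt_flow hY x
  have hφ0 : φ 0 x = x := hev.self_of_nhds.1
  have hnear : ∀ᶠ p : ℝ × Space n in 𝓝 (0, x), φ p.1 p.2 ∈ Ω ∧ Y (φ p.1 p.2) = X (φ p.1 p.2) := by
    have h1 : Filter.Tendsto (fun p : ℝ × Space n => φ p.1 p.2) (𝓝 (0, x)) (𝓝 x) := by
      simpa only [ContinuousAt, hφ0] using hφ.continuousAt
    exact h1.eventually ((hΩ.eventually_mem hx).and hYX)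
  have hall := (hev.and hnear).and (hφ.eventually (by simp))
  have hall' := hall.and ((hΩ.eventually_mem hx).prod_inr_nhds (0 : ℝ))
  rw [Filter.eventually_iff, mem_nhds_prod_iff] at hall'
  obtain ⟨T, hT, W, hW, hTW⟩ := hall'
  obtain ⟨ε, hε, hεT⟩ := Metric.mem_nhds_iff.1 hT
  obtain ⟨V, hVW, hV, hxV⟩ := mem_nhds_iff.1 hW
  have hmem : ∀ t ∈ Set.Ioo (-ε) ε, ∀ y ∈ V, _ := fun t ht y hy =>
    hTW (Set.mk_mem_prod (hεT (by simpa [abs_lt] using ht)) (hVW hy))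
  have h00 : (0 : ℝ) ∈ Set.Ioo (-ε) ε := by simpa using hε
  refine ⟨V, ε, φ, hxV, hV, fun y hy => (hmem 0 h00 y hy).2, hε,
    fun t ht y hy => (hmem t ht y hy).1.1.2.1, fun y hy => (hmem 0 h00 y hy).1.1.1.1, ?_, ?_⟩
  · intro t ht y hy
    have h := (hmem t ht y hy).1.1
    rw [← h.2.2]
    exact h.1.2
  · rintro ⟨t, y⟩ ⟨ht, hy⟩
    exact (hmem t ht y hy).1.2.contDiffWithinAt

end LocalFlow

end LevelSetAffine

namespace LevelSetAffine

open scoped Topology Matrix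

/-! ### Primitives of closed one-forms on simply connected sets -/

section Primitive

open Bundle

/-- On a simply connected space, functions given locally up to additive constants glue. -/
theorem exists_glue_of_simplyConnected {B : Type*} [TopologicalSpace B] [SimplyConnectedSpace B]
    [LocallyPathConnectedSpace B] (U : B → Set B) (hU : ∀ i, IsOpen (U i)) (hmem : ∀ x, x ∈ U x)
    (g : B → B → ℝ)
    (hloc : ∀ i j, ∀ x ∈ U i ∩ U j, ∀ᶠ y in 𝓝 x, g i y - g j y = g i x - g j x) :
    ∃ G : B → ℝ, ∀ x, ∀ᶠ y in 𝓝 x, G y - g x y = G x - g x x := by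
  let F := WithDiscreteTopology ℝ
  -- Gluing the pieces $U_i\times\mathbb R$, with $\mathbb R$ discrete, along the shifts $g_i-g_j$
  -- gives a covering, since the shifts are locally constant. Simple connectedness yields a global
  -- section.
  let Z : FiberBundleCore B B F :=
    { baseSet := U
      isOpen_baseSet := hU
      indexAt := id
      mem_baseSet_at := hmem
      coordChange := fun i j x c => .toTopology ⊥ (c.ofTopology + (g i x - g j x))
      coordChange_self := by
        rintro i x hx ⟨c⟩
        simp
      continuousOn_coordChange := by
        rintro i j ⟨x, c⟩ ⟨hx, -⟩
        refine ContinuousAt.continuousWithinAt ?_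
        rw [ContinuousAt, nhds_discrete F, Filter.tendsto_pure, nhds_prod_eq, nhds_discrete F,
          Filter.prod_pure, Filter.eventually_map]
        filter_upwards [hloc i j x hx] with y hy
        rw [hy]
      coordChange_comp := by
        rintro i j k x hx ⟨c⟩
        refine congrArg (WithTopology.toTopology ⊥) ?_
        simp only
        ring }
  have hcov : IsCoveringMap (π F Z.Fiber) := FiberBundle.isCoveringMap
  obtain ⟨x₀⟩ : Nonempty B := inferInstance
  obtain ⟨s, ⟨-, hs⟩, -⟩ := hcov.existsUnique_continuousMap_lifts (ContinuousMap.id B) x₀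
    (⟨x₀, (.toTopology ⊥ 0 : F)⟩ : TotalSpace F Z.Fiber) rfl
  have hsx : ∀ x, (s x).1 = x := fun x => congrFun hs x
  let val : TotalSpace F Z.Fiber → ℝ := fun p => WithTopology.ofTopology (t := ⊥) (p.2 : F)
  refine ⟨fun x => g x x + val (s x), fun x => ?_⟩
  -- The fibre coordinate of the section in the chart at $x$ is $G-g_x$; being continuous into a
  -- discrete space, it is locally constant.
  have hc : ContinuousAt (fun y => (Z.localTriv x (s y)).2) x := by
    have h1 : ContinuousAt (Z.localTriv x) (s x) := by
      refine (Z.localTriv x).continuousOn.continuousAt ((Z.localTriv x).open_source.mem_nhds ?_)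
      rw [Z.mem_localTriv_source]
      change (s x).1 ∈ U x
      rw [hsx]
      exact hmem x
    exact continuousAt_snd.comp (ContinuousAt.comp (g := Z.localTriv x) h1 s.continuous.continuousAt)
  rw [ContinuousAt, nhds_discrete F, Filter.tendsto_pure] at hc
  have hval : ∀ y, (Z.localTriv x (s y)).2 =
      (.toTopology ⊥ (val (s y) + (g y y - g x y)) : F) := by
    intro y
    rw [Z.localTriv_apply]
    change (.toTopology ⊥ (val (s y) + (g (s y).1 (s y).1 - g x (s y).1)) : F) = _
    rw [hsx]
  filter_upwards [hc] with y hy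
  rw [hval, hval] at hy
  have := congrArg (WithTopology.ofTopology (t := ⊥)) hy
  simp only at this
  linarith

variable {E : Type*} [NormedAddCommGroup E] [NormedSpace ℝ E]

theorem eventually_sub_eq_of_hasFDerivAt {θ : E → E →L[ℝ] ℝ} {f g : E → ℝ} {x : E}
    (hf : ∀ᶠ y in 𝓝 x, HasFDerivAt f (θ y) y) (hg : ∀ᶠ y in 𝓝 x, HasFDerivAt g (θ y) y) :
    ∀ᶠ y in 𝓝 x, f y - g y = f x - g x := by
  obtain ⟨r, hr, hball⟩ := Metric.eventually_nhds_iff_ball.1 (hf.and hg)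
  filter_upwards [Metric.ball_mem_nhds x hr] with y hy
  have hd : ∀ z ∈ Metric.ball x r, HasFDerivAt (fun z => f z - g z) (0 : E →L[ℝ] ℝ) z := by
    intro z hz
    have := (hball z hz).1.sub (hball z hz).2
    rwa [sub_self] at this
  exact (convex_ball x r).is_const_of_fderivWithin_eq_zero (𝕜 := ℝ)
    (fun z hz => (hd z hz).differentiableAt.differentiableWithinAt)
    (fun z hz => by
      rw [(hd z hz).hasFDerivWithinAt.fderivWithin
        (Metric.isOpen_ball.uniqueDiffWithinAt hz)]) hy (Metric.mem_ball_self hr)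

/-- The Poincaré lemma for one-forms on simply connected open sets. -/
theorem exists_hasFDerivAt_of_isSimplyConnected {θ : E → E →L[ℝ] ℝ} {Ω : Set E} (hΩ : IsOpen Ω)
    (hsc : IsSimplyConnected Ω) (hθ : DifferentiableOn ℝ θ Ω)
    (hdθ : ∀ x ∈ Ω, ∀ u v, fderiv ℝ θ x u v = fderiv ℝ θ x v u) :
    ∃ G : E → ℝ, ∀ x ∈ Ω, HasFDerivAt G (θ x) x := by
  have := hsc.simplyConnectedSpace
  have := hΩ.locallyPathConnectedSpace
  have hloc : ∀ x : Ω, ∃ r > 0, Metric.ball (x : E) r ⊆ Ω ∧ ∃ g : E → ℝ,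
      ∀ y ∈ Metric.ball (x : E) r, HasFDerivAt g (θ y) y := by
    intro x
    obtain ⟨r, hr, hball⟩ := Metric.isOpen_iff.1 hΩ x x.2
    exact ⟨r, hr, hball, (convex_ball (x : E) r).exists_forall_hasFDerivAt_of_fderiv_symmetric
      Metric.isOpen_ball (hθ.mono hball) fun a ha => hdθ a (hball ha)⟩
  choose r hr hball g hg using hloc
  have hgev : ∀ x : Ω, ∀ y : Ω, (y : E) ∈ Metric.ball (x : E) (r x) →
      ∀ᶠ z in 𝓝 (y : E), HasFDerivAt (g x) (θ z) z := fun x y hy => by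
    filter_upwards [Metric.isOpen_ball.mem_nhds hy] with z hz using hg x z hz
  obtain ⟨G, hG⟩ := exists_glue_of_simplyConnected
    (fun x : Ω => Subtype.val ⁻¹' Metric.ball (x : E) (r x))
    (fun x => Metric.isOpen_ball.preimage continuous_subtype_val)
    (fun x => Metric.mem_ball_self (hr x)) (fun x y => g x y)
    (fun i j x hx => continuous_subtype_val.continuousAt.eventually
      (eventually_sub_eq_of_hasFDerivAt (hgev i x hx.1) (hgev j x hx.2)))
  classical
  refine ⟨fun x => if h : x ∈ Ω then G ⟨x, h⟩ else 0, fun x hx => ?_⟩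
  have h1 : HasFDerivAt (fun y => g ⟨x, hx⟩ y + (G ⟨x, hx⟩ - g ⟨x, hx⟩ x)) (θ x) x :=
    (hg ⟨x, hx⟩ x (Metric.mem_ball_self (hr _))).add_const _
  refine h1.congr_of_eventuallyEq ?_
  have h2 := hG ⟨x, hx⟩
  rw [nhds_subtype, Filter.eventually_comap] at h2
  filter_upwards [h2, hΩ.mem_nhds hx] with y hy hyΩ
  have := hy ⟨y, hyΩ⟩ rfl
  simp only [dif_pos hyΩ]
  linarith

end Primitive

/-! ### Level sets near a regular point -/

section LevelSets

variable {E : Type*} [NormedAddCommGroup E] [NormedSpace ℝ E] [CompleteSpace E]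

/-- A parametrization of a level set near a regular point by a ball of its tangent space. -/
theorem exists_levelSet_param {F : E → ℝ} {x : E} (hF : ContDiffAt ℝ 1 F x)
    (hdF : fderiv ℝ F x ≠ 0) {S : Set E} (hS : S ∈ 𝓝 x) :
    ∃ r > 0, ∃ γ : LinearMap.ker (fderiv ℝ F x).toLinearMap → E,
      (∀ k ∈ Metric.ball 0 r, DifferentiableAt ℝ γ k ∧ γ k ∈ S ∧ F (γ k) = F x) ∧
      ∀ᶠ y in 𝓝 x, F y = F x → y ∈ γ '' Metric.ball 0 r := by
  set L := fderiv ℝ F x with hL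
  obtain ⟨w, hw⟩ : ∃ w, L w = 1 := by
    obtain ⟨v, hv⟩ := DFunLike.ne_iff.1 hdF
    refine ⟨(L v)⁻¹ • v, ?_⟩
    rw [map_smul, smul_eq_mul, inv_mul_cancel₀ hv]
  -- The correction along `w` makes $L\circ\Phi=F$ up to a constant, and $d\Phi_x$ is the identity.
  -- The local inverse carries $x+\ker L$ into the level set.
  let Φ : E → E := fun y => y + (F y - F x - L (y - x)) • w
  have hΦx : Φ x = x := by simp [Φ]
  have hLΦ : ∀ y, L (Φ y) = L x + (F y - F x) := by
    intro y
    simp only [Φ, map_add, map_smul, smul_eq_mul, hw, map_sub]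
    ring
  have hΦc : ContDiffAt ℝ 1 Φ x := by
    refine contDiffAt_id.add (ContDiffAt.smul ?_ contDiffAt_const)
    exact (hF.sub contDiffAt_const).sub
      (L.contDiff.contDiffAt.comp x (contDiffAt_id.sub contDiffAt_const))
  have hΦd : HasStrictFDerivAt Φ ((ContinuousLinearEquiv.refl ℝ E : E ≃L[ℝ] E) : E →L[ℝ] E) x := by
    refine (hΦc.hasStrictFDerivAt one_ne_zero).congr_fderiv ?_
    have h1 : HasFDerivAt (fun y => F y - F x - L (y - x)) (L - L) x :=
      ((hF.differentiableAt one_ne_zero).hasFDerivAt.sub_const _).sub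
        (L.hasFDerivAt.comp x ((hasFDerivAt_id x).sub_const x))
    have h2 : HasFDerivAt Φ (ContinuousLinearMap.id ℝ E + (L - L).smulRight w) x := by
      have := (hasFDerivAt_id x).add (h1.smul_const w)
      exact this
    rw [h2.fderiv]
    ext v
    simp
  let Ψ := hΦd.localInverse
  have hΨx : Ψ x = x := by
    have := hΦd.localInverse_apply_image
    rwa [hΦx] at this
  have hΨc : ContDiffAt ℝ 1 Ψ x := by
    have := hΦc.to_localInverse hΦd.hasFDerivAt one_ne_zero
    rwa [hΦx] at this
  have hΨr : ∀ᶠ z in 𝓝 x, Φ (Ψ z) = z := by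
    have := hΦd.eventually_right_inverse
    rwa [hΦx] at this
  have hΨl : ∀ᶠ y in 𝓝 x, Ψ (Φ y) = y := hΦd.eventually_left_inverse
  have hΨS : ∀ᶠ z in 𝓝 x, Ψ z ∈ S :=
    hΨc.continuousAt.tendsto.eventually (by rwa [hΨx])
  have hΨd : ∀ᶠ z in 𝓝 x, DifferentiableAt ℝ Ψ z :=
    (hΨc.eventually (by simp)).mono fun z hz => hz.differentiableAt one_ne_zero
  obtain ⟨r, hr, hball⟩ := Metric.eventually_nhds_iff_ball.1 (hΨr.and (hΨS.and hΨd))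
  refine ⟨r, hr, fun k => Ψ (x + k), fun k hk => ?_, ?_⟩
  · have hmem : x + (k : E) ∈ Metric.ball x r := by simpa using hk
    obtain ⟨h1, h2, h3⟩ := hball _ hmem
    refine ⟨?_, h2, ?_⟩
    · have h4 : DifferentiableAt ℝ (fun k : LinearMap.ker L.toLinearMap => x + (k : E)) k :=
        (differentiableAt_const x).add (Submodule.subtypeL _).differentiableAt
      exact DifferentiableAt.comp (g := Ψ) k h3 h4
    · have h4 := hLΦ (Ψ (x + k))
      have hk0 : L k = 0 := k.2
      rw [h1, map_add, hk0] at h4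
      linarith
  · have hΦS : ∀ᶠ y in 𝓝 x, Φ y ∈ Metric.ball x r :=
      hΦc.continuousAt.tendsto.eventually (by rw [hΦx]; exact Metric.ball_mem_nhds x hr)
    filter_upwards [hΨl, hΦS] with y hy1 hy2 hy3
    refine ⟨⟨Φ y - x, ?_⟩, ?_, ?_⟩
    · rw [LinearMap.mem_ker]
      change L (Φ y - x) = 0
      rw [map_sub, hLΦ, hy3]
      ring
    · simpa [dist_eq_norm] using hy2
    · simpa using hy1

/-- A function whose differential kills the tangent spaces of the level sets of `F` is locally
constant on them. -/
theorem eventually_eq_of_fderiv_ker {F g : E → ℝ} {x : E} (hF : ContDiffAt ℝ 1 F x)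
    (hdF : fderiv ℝ F x ≠ 0)
    (hg : ∀ᶠ y in 𝓝 x, DifferentiableAt ℝ F y ∧ DifferentiableAt ℝ g y ∧
      ∀ v, fderiv ℝ F y v = 0 → fderiv ℝ g y v = 0) :
    ∀ᶠ y in 𝓝 x, F y = F x → g y = g x := by
  obtain ⟨r, hr, γ, hγ, hev⟩ := exists_levelSet_param hF hdF hg
  have hd : ∀ k ∈ Metric.ball 0 r, HasFDerivAt (fun k => g (γ k)) 
      (0 : LinearMap.ker (fderiv ℝ F x).toLinearMap →L[ℝ] ℝ) k := by
    intro k hk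
    obtain ⟨h1, ⟨h2, h3, h4⟩, h5⟩ := hγ k hk
    have h6 : HasFDerivAt (fun k => F (γ k)) _ k := h2.hasFDerivAt.comp k h1.hasFDerivAt
    have h7 : HasFDerivAt (fun k => F (γ k))
        (0 : LinearMap.ker (fderiv ℝ F x).toLinearMap →L[ℝ] ℝ) k := by
      refine (hasFDerivAt_const (F x) k).congr_of_eventuallyEq ?_
      filter_upwards [Metric.isOpen_ball.mem_nhds hk] with l hl using (hγ l hl).2.2
    have h8 : HasFDerivAt (fun k => g (γ k)) _ k := h3.hasFDerivAt.comp k h1.hasFDerivAt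
    refine h8.congr_fderiv ?_
    ext v
    exact h4 _ (congrArg (fun T => T v) (h6.unique h7))
  have hconst : ∀ k ∈ Metric.ball 0 r, ∀ l ∈ Metric.ball 0 r, g (γ k) = g (γ l) := by
    intro k hk l hl
    exact (convex_ball 0 r).is_const_of_fderivWithin_eq_zero (𝕜 := ℝ)
      (f := fun k => g (γ k))
      (fun z hz => (hd z hz).differentiableAt.differentiableWithinAt)
      (fun z hz => by
        rw [(hd z hz).hasFDerivWithinAt.fderivWithin
          (Metric.isOpen_ball.uniqueDiffWithinAt hz)]) hk hl
  obtain ⟨k, hk, hkx⟩ := hev.self_of_nhds rfl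
  filter_upwards [hev] with y hy hFy
  obtain ⟨l, hl, rfl⟩ := hy hFy
  rw [hconst l hl k hk, hkx]

theorem exists_isPreconnected_levelSet {F : E → ℝ} {x : E} (hF : ContDiffAt ℝ 1 F x)
    (hdF : fderiv ℝ F x ≠ 0) {S : Set E} (hS : S ∈ 𝓝 x) :
    ∃ C ⊆ S ∩ {y | F y = F x}, IsPreconnected C ∧ x ∈ C ∧ ∀ᶠ y in 𝓝 x, F y = F x → y ∈ C := by
  obtain ⟨r, hr, γ, hγ, hev⟩ := exists_levelSet_param hF hdF hS
  refine ⟨γ '' Metric.ball 0 r, ?_, ?_, hev.self_of_nhds rfl, hev⟩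
  · rintro _ ⟨k, hk, rfl⟩
    exact (hγ k hk).2
  · exact (convex_ball 0 r).isPreconnected.image _ fun k hk =>
      (hγ k hk).1.continuousAt.continuousWithinAt

/-- A function locally constant on a level set of `F` has differential vanishing on the kernel of
`dF`. -/
theorem fderiv_eq_zero_of_eventually_eq {F g : E → ℝ} {x : E} (hF : ContDiffAt ℝ 1 F x)
    (hdF : fderiv ℝ F x ≠ 0) (hg : ContDiffAt ℝ 1 g x)
    (h : ∀ᶠ y in 𝓝 x, F y = F x → g y = g x) {v : E} (hv : fderiv ℝ F x v = 0) :
    fderiv ℝ g x v = 0 := by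
  -- A function constant on the level set near $x$ has a local extremum there, so Lagrange
  -- multipliers apply; the multiplier of $dg$ is nonzero because $dF\ne0$.
  have hext : IsLocalExtrOn g {y | F y = F x} x := by
    refine Or.inl ?_
    rw [IsMinFilter, eventually_nhdsWithin_iff]
    filter_upwards [h] with y hy hyF using (hy hyF).ge
  obtain ⟨a, b, hab, heq⟩ := hext.exists_multipliers_of_hasStrictFDerivAt_1d
    (hF.hasStrictFDerivAt one_ne_zero) (hg.hasStrictFDerivAt one_ne_zero)
  have h1 := congrArg (fun T => T v) heq
  simp only [add_apply, smul_apply, hv, mul_zero, zero_add, zero_apply, smul_eq_mul] at h1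
  rcases mul_eq_zero.1 h1 with hb | hb
  · rw [hb, zero_smul, add_zero] at heq
    rcases smul_eq_zero.1 heq with ha | ha
    · exact absurd (by rw [ha, hb]; rfl) hab
    · exact absurd ha hdF
  · exact hb

end LevelSets

end LevelSetAffine

namespace LevelSetAffine

open scoped Topology Matrix ContDiff

variable {n : ℕ}

/-! ### Symmetry of the Hessian and smoothness of the tensors -/

section Smoothness

theorem clm_apply_eq_sum (T : Space n →L[ℝ] ℝ) (v : Space n) :
    T v = ∑ i, v i * T (stdVec i) := by
  conv_lhs => rw [pi_eq_sum_univ' v]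
  simp [stdVec, map_sum]

theorem fderiv_apply_eq_dotProduct (F : Space n → ℝ) (x v : Space n) :
    fderiv ℝ F x v = v ⬝ᵥ grad F x := clm_apply_eq_sum _ _

theorem volCoeff_ne_zero {Ψ : TopForm n} (hΨ : Ψ ≠ 0) : volCoeff Ψ ≠ 0 := by
  have := (AlternatingMap.map_basis_ne_zero_iff (Pi.basisFun ℝ (Fin (n + 1))) Ψ).2 hΨ
  have he : (fun i : Fin (n + 1) => stdVec i) = Pi.basisFun ℝ (Fin (n + 1)) := by
    ext i : 1
    simp [stdVec]
  rwa [volCoeff, he]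

theorem grad_ne_zero {Ψ : TopForm n} {F : Space n → ℝ} {x : Space n} (hU : funU Ψ F x ≠ 0) :
    fderiv ℝ F x ≠ 0 := by
  intro h
  apply hU
  have : grad F x = 0 := by
    ext i
    simp [grad, h]
  simp [funU, this]

variable {F : Space n → ℝ} {x : Space n}

theorem hess_transpose (hF : ContDiffAt ℝ ∞ F x) : (hess F x)ᵀ = hess F x := by
  ext i j
  exact (hF.isSymmSndFDerivAt (by
    rw [minSmoothness_of_isRCLikeNormedField]
    exact WithTop.coe_le_coe.2 (le_top : (2 : ℕ∞) ≤ ⊤))) (stdVec j) (stdVec i)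

theorem contDiffAt_grad (hF : ContDiffAt ℝ ∞ F x) (i : Fin (n + 1)) :
    ContDiffAt ℝ ∞ (fun y => grad F y i) x :=
  (hF.fderiv_right (m := ∞) (by simp)).clm_apply contDiffAt_const

theorem contDiffAt_hess (hF : ContDiffAt ℝ ∞ F x) (i j : Fin (n + 1)) :
    ContDiffAt ℝ ∞ (fun y => hess F y i j) x :=
  (((hF.fderiv_right (m := ∞) (by simp)).fderiv_right (m := ∞) (by simp)).clm_apply
    contDiffAt_const).clm_apply contDiffAt_const

theorem contDiffAt_dotProduct {ι : Type*} [Fintype ι] {u v : Space n → ι → ℝ}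
    (hu : ∀ i, ContDiffAt ℝ ∞ (fun y => u y i) x) (hv : ∀ i, ContDiffAt ℝ ∞ (fun y => v y i) x) :
    ContDiffAt ℝ ∞ (fun y => u y ⬝ᵥ v y) x :=
  ContDiffAt.sum fun i _ => (hu i).mul (hv i)

theorem contDiffAt_fieldN (Ψ : TopForm n) (hF : ContDiffAt ℝ ∞ F x) (i : Fin (n + 1)) :
    ContDiffAt ℝ ∞ (fun y => fieldN Ψ F y i) x := by
  refine contDiffAt_dotProduct (fun j => ?_) (contDiffAt_grad hF)
  exact contDiffAt_const.mul (contDiffAt_adjugate (contDiffAt_hess hF) i j)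

theorem contDiffAt_fieldN' (Ψ : TopForm n) (hF : ContDiffAt ℝ ∞ F x) :
    ContDiffAt ℝ ∞ (fieldN Ψ F) x :=
  contDiffAt_pi.2 (contDiffAt_fieldN Ψ hF)

theorem contDiffAt_funU (Ψ : TopForm n) (hF : ContDiffAt ℝ ∞ F x) :
    ContDiffAt ℝ ∞ (funU Ψ F) x :=
  contDiffAt_dotProduct (contDiffAt_fieldN Ψ hF) (contDiffAt_grad hF)

theorem contDiffAt_hessDet (Ψ : TopForm n) (hF : ContDiffAt ℝ ∞ F x) :
    ContDiffAt ℝ ∞ (hessDet Ψ F) x :=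
  (contDiffAt_det (contDiffAt_hess hF)).div_const _

variable {Ψ : TopForm n}

theorem contDiffAt_abs_funU_rpow (hF : ContDiffAt ℝ ∞ F x) (hU : funU Ψ F x ≠ 0) (s : ℝ) :
    ContDiffAt ℝ ∞ (fun y => |funU Ψ F y| ^ s) x :=
  ((contDiffAt_abs hU).comp x (contDiffAt_funU Ψ hF)).rpow_const_of_ne (abs_ne_zero.2 hU)

theorem eventually_sign_funU (hF : ContDiffAt ℝ ∞ F x) (hU : funU Ψ F x ≠ 0) :
    ∀ᶠ y in 𝓝 x, Real.sign (funU Ψ F y) = Real.sign (funU Ψ F x) := by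
  have hc := (contDiffAt_funU Ψ hF).continuousAt
  rcases lt_or_gt_of_ne hU with h | h
  · filter_upwards [hc.eventually_lt continuousAt_const h] with y hy
    rw [Real.sign_of_neg hy, Real.sign_of_neg h]
  · filter_upwards [continuousAt_const.eventually_lt hc h] with y hy
    rw [Real.sign_of_pos hy, Real.sign_of_pos h]

theorem contDiffAt_formMu (hF : ContDiffAt ℝ ∞ F x) (hU : funU Ψ F x ≠ 0) :
    ContDiffAt ℝ ∞ (formMu Ψ F) x :=
  (((contDiffAt_funU Ψ hF).log hU).fderiv_right (m := ∞) (by simp)).const_smul _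

theorem contDiffAt_conormal (hF : ContDiffAt ℝ ∞ F x) (hU : funU Ψ F x ≠ 0) :
    ContDiffAt ℝ ∞ (conormal Ψ F) x :=
  (contDiffAt_abs_funU_rpow hF hU _).neg.smul (hF.fderiv_right (m := ∞) (by simp))

theorem contDiffAt_metricM (hF : ContDiffAt ℝ ∞ F x) (hU : funU Ψ F x ≠ 0) (i j : Fin (n + 1)) :
    ContDiffAt ℝ ∞ (fun y => metricM Ψ F y i j) x := by
  have hUi : ContDiffAt ℝ ∞ (fun y => (funU Ψ F y)⁻¹) x := (contDiffAt_funU Ψ hF).inv hU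
  have hff : ContDiffAt ℝ ∞ (fun y => grad F y i * grad F y j) x :=
    (contDiffAt_grad hF i).mul (contDiffAt_grad hF j)
  exact ((contDiffAt_hess hF i j).sub ((hUi.mul (contDiffAt_hessDet Ψ hF)).mul hff)).add
    (hUi.mul hff)

end Smoothness

/-! ### Pointwise algebra of $m$, $N$, $Z$ and the equiaffine normal -/

section PointwiseAlgebra

variable {Ψ : TopForm n} {F : Space n → ℝ} {x : Space n}

theorem dotProduct_adjugate_grad (hΨ : Ψ ≠ 0) :
    grad F x ⬝ᵥ (hess F x).adjugate *ᵥ grad F x = volCoeff Ψ ^ 2 * funU Ψ F x := by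
  have hv := volCoeff_ne_zero hΨ
  rw [funU, fieldN, adjTensor, Matrix.smul_mulVec, smul_dotProduct, smul_eq_mul,
    dotProduct_comm (grad F x)]
  field_simp

theorem metricM_eq (Ψ : TopForm n) (F : Space n → ℝ) (x : Space n) :
    metricM Ψ F x = hess F x + ((funU Ψ F x)⁻¹ * (1 - hessDet Ψ F x)) •
      Matrix.vecMulVec (grad F x) (grad F x) := by
  rw [metricM, secondLower, mul_sub, sub_smul, mul_one]
  abel

/-- The determinant lemma gives $c^2H+U^{-1}(1-H)\,c^2U$. So $m$ is invertible even where the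
Hessian is not. -/
theorem det_metricM (hΨ : Ψ ≠ 0) (hU : funU Ψ F x ≠ 0) :
    (metricM Ψ F x).det = volCoeff Ψ ^ 2 := by
  have hv := volCoeff_ne_zero hΨ
  rw [metricM_eq, det_add_smul_vecMulVec, dotProduct_adjugate_grad hΨ, hessDet]
  field_simp
  ring

theorem isUnit_det_metricM (hΨ : Ψ ≠ 0) (hU : funU Ψ F x ≠ 0) : IsUnit (metricM Ψ F x).det := by
  rw [det_metricM hΨ hU]
  exact isUnit_iff_ne_zero.2 (pow_ne_zero 2 (volCoeff_ne_zero hΨ))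

theorem hess_mulVec_fieldN (Ψ : TopForm n) (F : Space n → ℝ) (x : Space n) :
    hess F x *ᵥ fieldN Ψ F x = hessDet Ψ F x • grad F x := by
  rw [fieldN, adjTensor, Matrix.smul_mulVec, Matrix.mulVec_smul, Matrix.mulVec_mulVec,
    Matrix.mul_adjugate, Matrix.smul_mulVec, Matrix.one_mulVec, smul_smul, hessDet]
  congr 1
  ring

theorem metricM_mulVec_fieldN (hU : funU Ψ F x ≠ 0) :
    metricM Ψ F x *ᵥ fieldN Ψ F x = grad F x := by
  rw [metricM_eq, Matrix.add_mulVec, hess_mulVec_fieldN, Matrix.smul_mulVec,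
    Matrix.vecMulVec_mulVec, dotProduct_comm (grad F x)]
  change hessDet Ψ F x • grad F x + ((funU Ψ F x)⁻¹ * (1 - hessDet Ψ F x)) •
    MulOpposite.op (funU Ψ F x) • grad F x = _
  rw [op_smul_eq_smul, smul_smul, ← add_smul]
  have : hessDet Ψ F x + (funU Ψ F x)⁻¹ * (1 - hessDet Ψ F x) * funU Ψ F x = 1 := by
    field_simp
    ring
  rw [this, one_smul]

theorem metricM_inv_mulVec_grad (hΨ : Ψ ≠ 0) (hU : funU Ψ F x ≠ 0) :
    (metricM Ψ F x)⁻¹ *ᵥ grad F x = fieldN Ψ F x := by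
  rw [← metricM_mulVec_fieldN (Ψ := Ψ) hU, Matrix.mulVec_mulVec,
    Matrix.nonsing_inv_mul _ (isUnit_det_metricM hΨ hU), Matrix.one_mulVec]

theorem metricM_transpose (hF : ContDiffAt ℝ ∞ F x) : (metricM Ψ F x)ᵀ = metricM Ψ F x := by
  rw [metricM_eq, Matrix.transpose_add, hess_transpose hF, Matrix.transpose_smul,
    Matrix.transpose_vecMulVec]

theorem secondUpper_mulVec (v : Space n) :
    secondUpper Ψ F x *ᵥ v = (metricM Ψ F x)⁻¹ *ᵥ v -
      ((funU Ψ F x)⁻¹ * (fieldN Ψ F x ⬝ᵥ v)) • fieldN Ψ F x := by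
  rw [secondUpper, Matrix.sub_mulVec, Matrix.smul_mulVec, Matrix.vecMulVec_mulVec,
    op_smul_eq_smul, smul_smul]

/-- Since $m$ is symmetric and $m^{-1}dF=N$, pairing $m^{-1}\mu$ with $dF$ gives $\mu(N)$, which the
term $U^{-1}\mu(N)N$ cancels. -/
theorem fieldZ_dotProduct_grad (hΨ : Ψ ≠ 0) (hF : ContDiffAt ℝ ∞ F x) (hU : funU Ψ F x ≠ 0) :
    fieldZ Ψ F x ⬝ᵥ grad F x = 0 := by
  rw [fieldZ, smul_dotProduct, secondUpper_mulVec, sub_dotProduct, smul_dotProduct]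
  have h1 : ∀ v : Space n, ((metricM Ψ F x)⁻¹ *ᵥ v) ⬝ᵥ grad F x = fieldN Ψ F x ⬝ᵥ v := by
    intro v
    rw [dotProduct_comm, Matrix.dotProduct_mulVec, ← Matrix.mulVec_transpose,
      Matrix.transpose_nonsing_inv, metricM_transpose hF, metricM_inv_mulVec_grad hΨ hU]
  rw [h1]
  change _ • (_ - _ • funU Ψ F x) = 0
  simp only [smul_eq_mul]
  field_simp
  ring

/-- Up to the factor $U$, the field $Z$ is $m^{-1}\mu-U^{-1}\mu(N)N$. Applying $m$, which sends $N$
to $dF$, turns its vanishing into a relation between covectors. -/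
theorem fieldZ_eq_zero_iff (hΨ : Ψ ≠ 0) (hU : funU Ψ F x ≠ 0) :
    fieldZ Ψ F x = 0 ↔ ∀ u, formMu Ψ F x u =
      (funU Ψ F x)⁻¹ * formMu Ψ F x (fieldN Ψ F x) * fderiv ℝ F x u := by
  obtain ⟨μ, hμ⟩ : ∃ μ : Space n, μ = fun p => formMu Ψ F x (stdVec p) := ⟨_, rfl⟩
  have hμv : ∀ u, formMu Ψ F x u = u ⬝ᵥ μ := fun u => by rw [hμ]; exact clm_apply_eq_sum _ _
  have hN : formMu Ψ F x (fieldN Ψ F x) = fieldN Ψ F x ⬝ᵥ μ := hμv _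
  rw [fieldZ, smul_eq_zero, or_iff_right hU, ← hμ, secondUpper_mulVec, sub_eq_zero, hN]
  constructor
  · intro h u
    have h1 := congrArg (fun v => metricM Ψ F x *ᵥ v) h
    simp only [Matrix.mulVec_mulVec, Matrix.mul_nonsing_inv _ (isUnit_det_metricM hΨ hU),
      Matrix.one_mulVec, Matrix.mulVec_smul, metricM_mulVec_fieldN hU] at h1
    rw [hμv, fderiv_apply_eq_dotProduct]
    conv_lhs => rw [h1, dotProduct_smul, smul_eq_mul]
  · intro h
    have h1 : μ = ((funU Ψ F x)⁻¹ * (fieldN Ψ F x ⬝ᵥ μ)) • grad F x := by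
      ext p
      rw [Pi.smul_apply, smul_eq_mul, grad, ← h (stdVec p), hμ]
    conv_lhs => rw [h1]
    rw [Matrix.mulVec_smul, metricM_inv_mulVec_grad hΨ hU]

theorem wedgeFormsZero_iff (hΨ : Ψ ≠ 0) (hU : funU Ψ F x ≠ 0) :
    WedgeFormsZero (formMu Ψ F x) (conormal Ψ F x) ↔ fieldZ Ψ F x = 0 := by
  have ha : -(|funU Ψ F x| ^ (-(1 / ((n : ℝ) + 2)))) ≠ 0 :=
    neg_ne_zero.2 (Real.rpow_pos_of_pos (abs_pos.2 hU) _).ne'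
  have hw : WedgeFormsZero (formMu Ψ F x) (conormal Ψ F x) ↔
      ∀ u v, formMu Ψ F x u * fderiv ℝ F x v = formMu Ψ F x v * fderiv ℝ F x u := by
    refine forall₂_congr fun u v => ?_
    simp only [conormal, smul_apply, smul_eq_mul]
    rw [sub_eq_zero, mul_left_comm, mul_left_comm (formMu Ψ F x v), mul_right_inj' ha]
  have hN : fderiv ℝ F x (fieldN Ψ F x) = funU Ψ F x := fderiv_apply_eq_dotProduct _ _ _
  rw [hw, fieldZ_eq_zero_iff hΨ hU]
  constructor
  · intro h u
    have := h u (fieldN Ψ F x)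
    rw [hN] at this
    rw [mul_assoc, ← this]
    field_simp
  · intro h u v
    rw [h u, h v]
    ring

theorem normalCoeff_ne_zero (hU : funU Ψ F x ≠ 0) : -(Real.sign (funU Ψ F x) *
    |funU Ψ F x| ^ (-(((n : ℝ) + 1) / ((n : ℝ) + 2)))) ≠ 0 :=
  neg_ne_zero.2 (mul_ne_zero (by rwa [Ne, Real.sign_eq_zero_iff])
    (Real.rpow_pos_of_pos (abs_pos.2 hU) _).ne')

theorem eqNormal_eq_iff (hU : funU Ψ F x ≠ 0) :
    eqNormal Ψ F x = (-(Real.sign (funU Ψ F x) *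
      |funU Ψ F x| ^ (-(((n : ℝ) + 1) / ((n : ℝ) + 2))))) • fieldN Ψ F x ↔ fieldZ Ψ F x = 0 := by
  rw [eqNormal, smul_right_inj (normalCoeff_ne_zero hU), add_eq_left]

theorem wedgeVectorsZero_iff (hΨ : Ψ ≠ 0) (hF : ContDiffAt ℝ ∞ F x) (hU : funU Ψ F x ≠ 0) :
    WedgeVectorsZero (eqNormal Ψ F x) (fieldN Ψ F x) ↔ fieldZ Ψ F x = 0 := by
  have hc := normalCoeff_ne_zero hU
  constructor
  · intro h
    ext i
    have h1 : ∀ j, fieldZ Ψ F x i * fieldN Ψ F x j = fieldZ Ψ F x j * fieldN Ψ F x i := by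
      intro j
      have := h i j
      simp only [eqNormal, Pi.smul_apply, Pi.add_apply, smul_eq_mul] at this
      refine mul_left_cancel₀ hc ?_
      linear_combination this
    -- Contract $Z^iN^j=Z^jN^i$ with $F_j$: a multiple of the transverse $N$ that is tangent to the
    -- level set must vanish.
    have h2 : fieldZ Ψ F x i * funU Ψ F x =
        (fieldZ Ψ F x ⬝ᵥ grad F x) * fieldN Ψ F x i := by
      simp only [funU, dotProduct, Finset.mul_sum, Finset.sum_mul]
      refine Finset.sum_congr rfl fun j _ => ?_
      rw [← mul_assoc, h1]
      ring
    rw [fieldZ_dotProduct_grad hΨ hF hU, zero_mul] at h2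
    exact (mul_eq_zero.1 h2).resolve_right hU
  · intro h i j
    simp only [eqNormal, h, add_zero, Pi.smul_apply, smul_eq_mul]
    ring

/-- The equiaffine normal is transverse to the level sets: `dF(ν) = -|U(F)|^{1/(n+2)}`. -/
theorem fderiv_eqNormal (hΨ : Ψ ≠ 0) (hF : ContDiffAt ℝ ∞ F x) (hU : funU Ψ F x ≠ 0) :
    fderiv ℝ F x (eqNormal Ψ F x) = -(|funU Ψ F x| ^ (1 / ((n : ℝ) + 2))) := by
  rw [fderiv_apply_eq_dotProduct, eqNormal, smul_dotProduct, add_dotProduct,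
    fieldZ_dotProduct_grad hΨ hF hU, add_zero]
  change _ • funU Ψ F x = _
  have hs : Real.sign (funU Ψ F x) * funU Ψ F x = |funU Ψ F x| := by
    rcases lt_or_gt_of_ne hU with h | h
    · rw [Real.sign_of_neg h, abs_of_neg h, neg_one_mul]
    · rw [Real.sign_of_pos h, abs_of_pos h, one_mul]
  have hn : ((n : ℝ) + 2) ≠ 0 := by positivity
  have he : (1 : ℝ) / ((n : ℝ) + 2) = -(((n : ℝ) + 1) / ((n : ℝ) + 2)) + 1 := by
    field_simp
    ring
  rw [smul_eq_mul, neg_mul, mul_right_comm, hs, he, Real.rpow_add (abs_pos.2 hU), Real.rpow_one,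
    mul_comm]

theorem conormal_eqNormal (hΨ : Ψ ≠ 0) (hF : ContDiffAt ℝ ∞ F x) (hU : funU Ψ F x ≠ 0) :
    conormal Ψ F x (eqNormal Ψ F x) = 1 := by
  rw [conormal, smul_apply, fderiv_eqNormal hΨ hF hU, smul_eq_mul, neg_mul_neg,
    ← Real.rpow_add (abs_pos.2 hU), neg_add_cancel, Real.rpow_zero]

theorem contDiffAt_eqNormal (hΨ : Ψ ≠ 0) (hF : ContDiffAt ℝ ∞ F x) (hU : funU Ψ F x ≠ 0) :
    ContDiffAt ℝ ∞ (eqNormal Ψ F) x := by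
  have hm : ∀ i j, ContDiffAt ℝ ∞ (fun y => (metricM Ψ F y)⁻¹ i j) x := by
    intro i j
    simp only [Matrix.inv_def, Matrix.smul_apply, Ring.inverse_eq_inv', smul_eq_mul]
    refine ((contDiffAt_det (contDiffAt_metricM hF hU)).inv ?_).mul
      (contDiffAt_adjugate (contDiffAt_metricM hF hU) i j)
    exact (isUnit_det_metricM hΨ hU).ne_zero
  have hU' := contDiffAt_funU Ψ hF
  have hP : ∀ i j, ContDiffAt ℝ ∞ (fun y => secondUpper Ψ F y i j) x := fun i j =>
    (hm i j).sub ((hU'.inv hU).mul ((contDiffAt_fieldN Ψ hF i).mul (contDiffAt_fieldN Ψ hF j)))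
  have hZ : ContDiffAt ℝ ∞ (fieldZ Ψ F) x := by
    refine hU'.smul (contDiffAt_pi.2 fun i => contDiffAt_dotProduct (hP i) fun p => ?_)
    exact (contDiffAt_formMu hF hU).clm_apply contDiffAt_const
  have hs : ContDiffAt ℝ ∞ (fun y => Real.sign (funU Ψ F y)) x :=
    contDiffAt_const.congr_of_eventuallyEq (eventually_sign_funU hF hU)
  exact (hs.mul (contDiffAt_abs_funU_rpow hF hU _)).neg.smul ((contDiffAt_fieldN' Ψ hF).add hZ)

end PointwiseAlgebra

end LevelSetAffine

namespace LevelSetAffine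

open scoped Topology Matrix ContDiff

variable {n : ℕ} {Ψ : TopForm n} {F : Space n → ℝ} {Ω : Set (Space n)}

/-! ### The identity $d\rho=-\mu\wedge\rho$ and closedness of the conormal -/

section Forms

theorem isClosedOn_iff {θ : Space n → Space n →L[ℝ] ℝ} (hθ : ∀ x ∈ Ω, DifferentiableAt ℝ θ x) :
    IsClosedOn θ Ω ↔ ∀ x ∈ Ω, ∀ u v, fderiv ℝ θ x u v = fderiv ℝ θ x v u := by
  refine forall₂_congr fun x hx => ?_
  have hd : fderiv ℝ (fun y => ContinuousAlternatingMap.ofSubsingleton ℝ (Space n) ℝ (0 : Fin 1)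
      (θ y)) x = ((ContinuousAlternatingMap.ofSubsingletonLIE (𝕜 := ℝ) (E := Space n) (F := ℝ)
        (0 : Fin 1)).toContinuousLinearEquiv :
        (Space n →L[ℝ] ℝ) →L[ℝ] (Space n [⋀^Fin 1]→L[ℝ] ℝ)).comp (fderiv ℝ θ x) :=
    (((ContinuousAlternatingMap.ofSubsingletonLIE (𝕜 := ℝ) (E := Space n) (F := ℝ)
        (0 : Fin 1)).toContinuousLinearEquiv :
        (Space n →L[ℝ] ℝ) →L[ℝ] (Space n [⋀^Fin 1]→L[ℝ] ℝ)).hasFDerivAt.comp x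
          (hθ x hx).hasFDerivAt).fderiv
  have happ : ∀ v : Fin 2 → Space n, extDeriv (fun y =>
      ContinuousAlternatingMap.ofSubsingleton ℝ (Space n) ℝ (0 : Fin 1) (θ y)) x v =
      fderiv ℝ θ x (v 0) (v 1) - fderiv ℝ θ x (v 1) (v 0) := by
    intro v
    rw [extDeriv, hd, ContinuousAlternatingMap.alternatizeUncurryFin_apply, Fin.sum_univ_two]
    simp [Fin.removeNth, Fin.tail, sub_eq_add_neg]
  constructor
  · intro h u v
    have := happ ![u, v]
    rw [h] at this
    exact sub_eq_zero.1 (by simpa using this.symm)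
  · intro h
    ext v
    rw [happ, h, sub_self]
    rfl

variable {x : Space n}

theorem formMu_apply (hF : ContDiffAt ℝ ∞ F x) (hU : funU Ψ F x ≠ 0) (v : Space n) :
    formMu Ψ F x v = ((n : ℝ) + 2)⁻¹ * ((funU Ψ F x)⁻¹ * fderiv ℝ (funU Ψ F) x v) := by
  have h := ((contDiffAt_funU Ψ hF).differentiableAt (by simp)).hasFDerivAt.log hU
  rw [formMu, h.fderiv]
  rfl

/-- Writing $|U|^s=\exp(s\log|U|)$ brings out $d\log|U|=(n+2)\mu$. -/
theorem hasFDerivAt_abs_funU_rpow (hF : ContDiffAt ℝ ∞ F x) (hU : funU Ψ F x ≠ 0) (s : ℝ) :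
    HasFDerivAt (fun y => |funU Ψ F y| ^ s)
      ((s * |funU Ψ F x| ^ s * ((n : ℝ) + 2)) • formMu Ψ F x) x := by
  have hn : ((n : ℝ) + 2) ≠ 0 := by positivity
  have hd := ((contDiffAt_funU Ψ hF).differentiableAt (by simp)).hasFDerivAt
  have h1 : HasFDerivAt (fun y => Real.exp (Real.log (funU Ψ F y) * s)) _ x :=
    ((hd.log hU).mul_const s).exp
  have h2 : (fun y => |funU Ψ F y| ^ s) =ᶠ[𝓝 x]
      fun y => Real.exp (Real.log (funU Ψ F y) * s) := by
    filter_upwards [hd.continuousAt.eventually_ne hU] with y hy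
    rw [Real.rpow_def_of_pos (abs_pos.2 hy), Real.log_abs]
  refine (h1.congr_of_eventuallyEq h2).congr_fderiv ?_
  have h3 : |funU Ψ F x| ^ s = Real.exp (Real.log (funU Ψ F x) * s) := h2.self_of_nhds
  rw [← h3]
  ext v
  simp only [smul_apply, smul_eq_mul, formMu_apply hF hU]
  field_simp

/-- The Hessian of $F$ is symmetric and drops out; only the derivative of $|U|^{-1/(n+2)}$, equal to
$-|U|^{-1/(n+2)}\mu$, survives. -/
theorem fderiv_conormal_sub (hF : ContDiffAt ℝ ∞ F x) (hU : funU Ψ F x ≠ 0) (u v : Space n) :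
    fderiv ℝ (conormal Ψ F) x u v - fderiv ℝ (conormal Ψ F) x v u =
      -(formMu Ψ F x u * conormal Ψ F x v - formMu Ψ F x v * conormal Ψ F x u) := by
  have hn : ((n : ℝ) + 2) ≠ 0 := by positivity
  have h1 := (hasFDerivAt_abs_funU_rpow hF hU (-(1 / ((n : ℝ) + 2)))).neg
  have h2 : HasFDerivAt (fun y => fderiv ℝ F y) (fderiv ℝ (fun y => fderiv ℝ F y) x) x :=
    ((hF.fderiv_right (m := ∞) (by simp)).differentiableAt (by simp)).hasFDerivAt
  have h3 : HasFDerivAt (conormal Ψ F) _ x := h1.smul h2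
  have hs : fderiv ℝ (fun y => fderiv ℝ F y) x u v = fderiv ℝ (fun y => fderiv ℝ F y) x v u :=
    (hF.isSymmSndFDerivAt (by
      rw [minSmoothness_of_isRCLikeNormedField]
      exact WithTop.coe_le_coe.2 (le_top : (2 : ℕ∞) ≤ ⊤))) u v
  rw [h3.fderiv]
  simp only [conormal, add_apply, smul_apply, neg_apply, smul_eq_mul,
    ContinuousLinearMap.smulRight_apply, hs, Pi.neg_apply]
  field_simp
  ring

theorem isClosedOn_conormal_iff (hF : ∀ x ∈ Ω, ContDiffAt ℝ ∞ F x)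
    (hU : ∀ x ∈ Ω, funU Ψ F x ≠ 0) :
    IsClosedOn (conormal Ψ F) Ω ↔ ∀ x ∈ Ω, WedgeFormsZero (formMu Ψ F x) (conormal Ψ F x) := by
  rw [isClosedOn_iff fun x hx =>
    (contDiffAt_conormal (hF x hx) (hU x hx)).differentiableAt (by simp)]
  refine forall₂_congr fun x hx => forall₂_congr fun u v => ?_
  rw [← sub_eq_zero, fderiv_conormal_sub (hF x hx) (hU x hx), neg_eq_zero]

theorem conormal_eq_zero_iff (hU : funU Ψ F x ≠ 0) (v : Space n) :
    conormal Ψ F x v = 0 ↔ fderiv ℝ F x v = 0 := by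
  have ha : -(|funU Ψ F x| ^ (-(1 / ((n : ℝ) + 2)))) ≠ 0 :=
    neg_ne_zero.2 (Real.rpow_pos_of_pos (abs_pos.2 hU) _).ne'
  rw [conormal, smul_apply, smul_eq_mul, mul_eq_zero, or_iff_right ha]

theorem wedgeFormsZero_iff_ker (hU : funU Ψ F x ≠ 0) (hF : ContDiffAt ℝ ∞ F x) :
    WedgeFormsZero (formMu Ψ F x) (conormal Ψ F x) ↔
      ∀ v, fderiv ℝ F x v = 0 → fderiv ℝ (funU Ψ F) x v = 0 := by
  have hn : ((n : ℝ) + 2)⁻¹ ≠ 0 := by positivity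
  have hμ : ∀ v, formMu Ψ F x v = 0 ↔ fderiv ℝ (funU Ψ F) x v = 0 := by
    intro v
    rw [formMu_apply hF hU, mul_eq_zero, or_iff_right hn, mul_eq_zero,
      or_iff_right (inv_ne_zero hU)]
  simp only [← hμ, ← conormal_eq_zero_iff hU (Ψ := Ψ)]
  constructor
  · intro h v hv
    obtain ⟨w, hw⟩ := DFunLike.ne_iff.1 (grad_ne_zero hU)
    have hw' : conormal Ψ F x w ≠ 0 := fun h0 => hw ((conormal_eq_zero_iff hU w).1 h0)
    have := h v w
    rw [hv, mul_zero, sub_zero] at this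
    exact (mul_eq_zero.1 this).resolve_right hw'
  · intro h u v
    -- This vector lies in $\ker\rho$, and its image under $\mu$ is $(\mu\wedge\rho)(u,v)$.
    have := h (conormal Ψ F x v • u - conormal Ψ F x u • v) (by
      simp only [map_sub, map_smul, smul_eq_mul]
      ring)
    simp only [map_sub, map_smul, smul_eq_mul] at this
    linear_combination this

end Forms

/-! ### Local constancy of $U(F)$ on the level sets -/

section LevelSets

theorem forall_isLocallyConstant_iff (hΩ : IsOpen Ω) (g : Space n → ℝ) :
    (∀ r ∈ F '' Ω, IsLocallyConstant (fun x : levelSet F Ω r => g (x : Space n))) ↔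
      ∀ x ∈ Ω, ∀ᶠ y in 𝓝 x, F y = F x → g y = g x := by
  constructor
  · intro h x hx
    have h1 := (h (F x) ⟨x, hx, rfl⟩).eventually_eq ⟨x, hx, rfl⟩
    rw [nhds_subtype, Filter.eventually_comap] at h1
    filter_upwards [h1, hΩ.mem_nhds hx] with y hy hyΩ hyF
    exact hy ⟨y, hyΩ, hyF⟩ rfl
  · rintro h r -
    rw [IsLocallyConstant.iff_eventually_eq]
    rintro ⟨x, hx, hxr⟩
    rw [nhds_subtype, Filter.eventually_comap]
    filter_upwards [h x hx] with y hy
    rintro ⟨z, hz, hzr⟩ rfl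
    exact hy (hzr.trans hxr.symm)

theorem forall_isLocallyConstant_funU_iff (hΩ : IsOpen Ω) (hF : ∀ x ∈ Ω, ContDiffAt ℝ ∞ F x)
    (hU : ∀ x ∈ Ω, funU Ψ F x ≠ 0) :
    (∀ r ∈ F '' Ω, IsLocallyConstant (fun x : levelSet F Ω r => funU Ψ F (x : Space n))) ↔
      ∀ x ∈ Ω, WedgeFormsZero (formMu Ψ F x) (conormal Ψ F x) := by
  rw [forall_isLocallyConstant_iff hΩ]
  constructor
  · intro h x hx
    rw [wedgeFormsZero_iff_ker (hU x hx) (hF x hx)]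
    exact fun v hv => fderiv_eq_zero_of_eventually_eq ((hF x hx).of_le (by simp))
      (grad_ne_zero (hU x hx)) ((contDiffAt_funU Ψ (hF x hx)).of_le (by simp)) (h x hx) hv
  · intro h x hx
    refine eventually_eq_of_fderiv_ker ((hF x hx).of_le (by simp)) (grad_ne_zero (hU x hx)) ?_
    filter_upwards [hΩ.mem_nhds hx] with y hy
    exact ⟨(hF y hy).differentiableAt (by simp),
      (contDiffAt_funU Ψ (hF y hy)).differentiableAt (by simp),
      (wedgeFormsZero_iff_ker (hU y hy) (hF y hy)).1 (h y hy)⟩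

end LevelSets

/-! ### Conditions on the flow of the equiaffine normal -/

section Flows

theorem sign_mul_abs_self (r : ℝ) : Real.sign r * |r| = r := by
  rcases lt_trichotomy r 0 with h | rfl | h
  · rw [Real.sign_of_neg h, abs_of_neg h, neg_one_mul, neg_neg]
  · simp
  · rw [Real.sign_of_pos h, abs_of_pos h, one_mul]

theorem eq_of_isPreconnected {X Y : Type*} [TopologicalSpace X] {S : Set X}
    (hS : IsPreconnected S) {f : X → Y} (hf : ∀ x ∈ S, ∀ᶠ y in 𝓝[S] x, f y = f x) {x y : X}
    (hx : x ∈ S) (hy : y ∈ S) : f x = f y := by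
  have := isPreconnected_iff_preconnectedSpace.1 hS
  have hl : IsLocallyConstant fun z : S => f z := by
    rw [IsLocallyConstant.iff_eventually_eq]
    intro z
    rw [nhds_subtype_eq_comap_nhdsWithin, Filter.eventually_comap]
    filter_upwards [hf z z.2] with w hw
    rintro a rfl
    exact hw
  exact hl.apply_eq_of_preconnectedSpace ⟨x, hx⟩ ⟨y, hy⟩

variable {X : Space n → Space n} {V : Set (Space n)} {ε : ℝ} {φ : ℝ → Space n → Space n}

theorem IsLocalFlow.contDiffAt (h : IsLocalFlow X Ω V ε φ) {t : ℝ} (ht : t ∈ Set.Ioo (-ε) ε)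
    {y : Space n} (hy : y ∈ V) : ContDiffAt ℝ 1 (fun p : ℝ × Space n => φ p.1 p.2) (t, y) :=
  h.contDiffOn.contDiffAt ((isOpen_Ioo.prod h.isOpen).mem_nhds ⟨ht, hy⟩)

theorem IsLocalFlow.differentiableAt (h : IsLocalFlow X Ω V ε φ) {t : ℝ}
    (ht : t ∈ Set.Ioo (-ε) ε) {y : Space n} (hy : y ∈ V) : DifferentiableAt ℝ (φ t) y :=
  DifferentiableAt.comp (g := fun p : ℝ × Space n => φ p.1 p.2) y
    ((h.contDiffAt ht hy).differentiableAt one_ne_zero)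
    ((differentiableAt_const t).prodMk differentiableAt_id)

/-- As $\rho$ and $dF$ have the same kernel, $\varphi_t^*\rho=\rho$ makes $d(F\circ\varphi_t)$
vanish on $\ker dF$. So $F\circ\varphi_t$ is locally constant on level sets, hence constant on
connected pieces. -/
theorem flowPreservesLevelSets_of_flowPreservesForm (hF : ∀ x ∈ Ω, ContDiffAt ℝ ∞ F x)
    (hU : ∀ x ∈ Ω, funU Ψ F x ≠ 0) (h : FlowPreservesForm X (conormal Ψ F) Ω) :
    FlowPreservesLevelSets X F Ω := by
  intro V ε φ hφ t ht r C hC hCc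
  have hd : ∀ y ∈ V, HasFDerivAt (fun y => F (φ t y))
      ((fderiv ℝ F (φ t y)).comp (fderiv ℝ (φ t) y)) y := fun y hy =>
    ((hF _ (hφ.mem t ht y hy)).differentiableAt (by simp)).hasFDerivAt.comp y
      (hφ.differentiableAt ht hy).hasFDerivAt
  have hloc : ∀ y ∈ C, ∀ᶠ z in 𝓝[C] y, F (φ t z) = F (φ t y) := by
    intro y hy
    have hyV := (hC hy).1
    have hyΩ := hφ.subset hyV
    have h1 := eventually_eq_of_fderiv_ker (g := fun y => F (φ t y))
      ((hF y hyΩ).of_le (by simp)) (grad_ne_zero (hU y hyΩ)) (by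
        filter_upwards [hφ.isOpen.mem_nhds hyV] with z hz
        have hzΩ := hφ.subset hz
        refine ⟨(hF z hzΩ).differentiableAt (by simp), (hd z hz).differentiableAt, fun v hv => ?_⟩
        rw [(hd z hz).fderiv, ContinuousLinearMap.comp_apply,
          ← conormal_eq_zero_iff (hU _ (hφ.mem t ht z hz)), ← ContinuousLinearMap.comp_apply,
          h V ε φ hφ t ht z hz, conormal_eq_zero_iff (hU z hzΩ)]
        exact hv)
    filter_upwards [nhdsWithin_le_nhds h1, self_mem_nhdsWithin] with z hz hzC
    exact hz ((hC hzC).2.2.trans (hC hy).2.2.symm)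
  rcases C.eq_empty_or_nonempty with rfl | ⟨y₀, hy₀⟩
  · exact ⟨0, by simp⟩
  · refine ⟨F (φ t y₀), ?_⟩
    rintro _ ⟨y, hy, rfl⟩
    exact ⟨hφ.mem t ht y (hC hy).1, eq_of_isPreconnected hCc hloc hy hy₀⟩

theorem flowPreservesForm_of_isClosedOn (hΩ : IsOpen Ω) {θ : Space n → Space n →L[ℝ] ℝ}
    (hθ : ∀ x ∈ Ω, DifferentiableAt ℝ θ x) (hθX : ∀ x ∈ Ω, θ x (X x) = 1)
    (hcl : IsClosedOn θ Ω) : FlowPreservesForm X θ Ω := by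
  intro V ε φ hφ t ht y hy
  rw [isClosedOn_iff hθ] at hcl
  have h0 : (0 : ℝ) ∈ Set.Ioo (-ε) ε := by simpa using hφ.pos
  -- Near $\varphi_{t_0}(y)$ write $\theta=dG$. Since $\theta(X)=1$, one has
  -- $G\circ\varphi_t=G\circ\varphi_{t_0}+(t-t_0)$, and differentiating in space shows
  -- $\varphi_t^*\theta$ locally constant in $t$. Connectedness of the time interval then compares
  -- it with $t=0$.
  have hloc : ∀ t₀ ∈ Set.Ioo (-ε) ε, ∀ᶠ t in 𝓝[Set.Ioo (-ε) ε] t₀,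
      (θ (φ t y)).comp (fderiv ℝ (φ t) y) = (θ (φ t₀ y)).comp (fderiv ℝ (φ t₀) y) := by
    intro t₀ ht₀
    obtain ⟨R, hR, hball⟩ := Metric.isOpen_iff.1 hΩ _ (hφ.mem t₀ ht₀ y hy)
    obtain ⟨G, hG⟩ := (convex_ball (φ t₀ y) R).exists_forall_hasFDerivAt_of_fderiv_symmetric
      Metric.isOpen_ball (fun z hz => (hθ z (hball hz)).differentiableWithinAt)
      (fun z hz => hcl z (hball hz))
    have hnear : ∀ᶠ p : ℝ × Space n in 𝓝 (t₀, y), φ p.1 p.2 ∈ Metric.ball (φ t₀ y) R ∧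
        p.1 ∈ Set.Ioo (-ε) ε ∧ p.2 ∈ V :=
      ((hφ.contDiffAt ht₀ hy).continuousAt.tendsto.eventually (Metric.ball_mem_nhds _ hR)).and
        ((isOpen_Ioo.prod hφ.isOpen).mem_nhds ⟨ht₀, hy⟩)
    obtain ⟨δ, hδ, hδb⟩ := Metric.eventually_nhds_iff_ball.1 hnear
    have hmem : ∀ t ∈ Metric.ball t₀ δ, ∀ z ∈ Metric.ball y δ, _ := fun t ht z hz =>
      hδb (t, z) (by rw [← ball_prod_same]; exact ⟨ht, hz⟩)
    have hG' : ∀ t ∈ Metric.ball t₀ δ, ∀ z ∈ Metric.ball y δ,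
        HasFDerivAt (fun z => G (φ t z)) ((θ (φ t z)).comp (fderiv ℝ (φ t) z)) z :=
      fun t ht z hz => (hG _ (hmem t ht z hz).1).comp z
        (hφ.differentiableAt (hmem t ht z hz).2.1 (hmem t ht z hz).2.2).hasFDerivAt
    have hlin : ∀ t ∈ Metric.ball t₀ δ, ∀ z ∈ Metric.ball y δ,
        G (φ t z) = G (φ t₀ z) + (t - t₀) := by
      intro t ht z hz
      have hd : ∀ s ∈ Metric.ball t₀ δ,
          HasFDerivAt (fun s => G (φ s z) - s) (0 : ℝ →L[ℝ] ℝ) s := by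
        intro s hs
        obtain ⟨h1, h2, h3⟩ := hmem s hs z hz
        have h4 := (hG _ h1).comp_hasDerivAt s (hφ.hasDerivAt s h2 z h3)
        simp only [hθX _ (hball h1)] at h4
        have h5 := h4.sub (hasDerivAt_id s)
        rw [sub_self] at h5
        refine HasFDerivAt.congr_fderiv h5.hasFDerivAt ?_
        ext
        simp
      have := (convex_ball t₀ δ).is_const_of_fderivWithin_eq_zero (𝕜 := ℝ)
        (f := fun s => G (φ s z) - s)
        (fun s hs => (hd s hs).differentiableAt.differentiableWithinAt)
        (fun s hs => by
          rw [(hd s hs).hasFDerivWithinAt.fderivWithin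
            (Metric.isOpen_ball.uniqueDiffWithinAt hs)]) ht (Metric.mem_ball_self hδ)
      linarith
    filter_upwards [nhdsWithin_le_nhds (Metric.ball_mem_nhds t₀ hδ)] with t ht
    have hy' := Metric.mem_ball_self (x := y) hδ
    refine (hG' t ht y hy').unique
      (((hG' t₀ (Metric.mem_ball_self hδ) y hy').add_const (t - t₀)).congr_of_eventuallyEq ?_)
    filter_upwards [Metric.ball_mem_nhds y hδ] with z hz using hlin t ht z hz
  rw [eq_of_isPreconnected (f := fun t => (θ (φ t y)).comp (fderiv ℝ (φ t) y))
    isPreconnected_Ioo hloc ht h0]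
  have hid : φ 0 =ᶠ[𝓝 y] id := by
    filter_upwards [hφ.isOpen.mem_nhds hy] with z hz using hφ.zero z hz
  rw [hid.fderiv_eq, fderiv_id, hφ.zero y hy, ContinuousLinearMap.comp_id]

theorem eventually_funU_eq_of_flowPreservesLevelSets (hΨ : Ψ ≠ 0) (hΩ : IsOpen Ω)
    (hF : ∀ x ∈ Ω, ContDiffAt ℝ ∞ F x) (hU : ∀ x ∈ Ω, funU Ψ F x ≠ 0)
    (h : FlowPreservesLevelSets (eqNormal Ψ F) F Ω) :
    ∀ x ∈ Ω, ∀ᶠ y in 𝓝 x, F y = F x → funU Ψ F y = funU Ψ F x := by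
  intro x hx
  have hX : ContDiffOn ℝ 1 (eqNormal Ψ F) Ω := fun y hy =>
    ((contDiffAt_eqNormal hΨ (hF y hy) (hU y hy)).of_le (by simp)).contDiffWithinAt
  obtain ⟨V, ε, φ, hxV, hφ⟩ := exists_isLocalFlow hΩ hX hx
  -- The flow only determines $|U|$, through $dF(\nu)$, so the sign is fixed beforehand by shrinking
  -- the neighbourhood.
  have hS : ∀ᶠ y in 𝓝 x, y ∈ V ∧ Real.sign (funU Ψ F y) = Real.sign (funU Ψ F x) :=
    (hφ.isOpen.eventually_mem hxV).and (eventually_sign_funU (hF x hx) (hU x hx))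
  obtain ⟨C, hCS, hC, hxC, hev⟩ := exists_isPreconnected_levelSet ((hF x hx).of_le (by simp))
    (grad_ne_zero (hU x hx)) hS
  have h0 : (0 : ℝ) ∈ Set.Ioo (-ε) ε := by simpa using hφ.pos
  have hder : ∀ y ∈ V, HasDerivAt (fun t => F (φ t y))
      (-(|funU Ψ F y| ^ (1 / ((n : ℝ) + 2)))) 0 := by
    intro y hy
    have h1 := hφ.hasDerivAt 0 h0 y hy
    have h2 : HasFDerivAt F (fderiv ℝ F (φ 0 y)) (φ 0 y) :=
      ((hF _ (hφ.mem 0 h0 y hy)).differentiableAt (by simp)).hasFDerivAt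
    have h3 := h2.comp_hasDerivAt 0 h1
    rw [hφ.zero y hy] at h3
    rwa [fderiv_eqNormal hΨ (hF y (hφ.subset hy)) (hU y (hφ.subset hy))] at h3
  filter_upwards [hev] with y hy hyF
  have hyC := hy hyF
  obtain ⟨⟨hyV, hys⟩, -⟩ := hCS hyC
  have heq : (fun t => F (φ t y)) =ᶠ[𝓝 0] fun t => F (φ t x) := by
    filter_upwards [isOpen_Ioo.mem_nhds h0] with t ht
    obtain ⟨s, hs⟩ := h V ε φ hφ t ht (F x) C
      (fun z hz => ⟨(hCS hz).1.1, hφ.subset (hCS hz).1.1, (hCS hz).2⟩) hC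
    rw [(hs ⟨y, hyC, rfl⟩).2, (hs ⟨x, hxC, rfl⟩).2]
  have hd := (hder y hyV).unique ((hder x hxV).congr_of_eventuallyEq heq)
  have hn : (1 / ((n : ℝ) + 2)) ≠ 0 := by positivity
  have habs : |funU Ψ F y| = |funU Ψ F x| :=
    (Real.rpow_left_inj (abs_nonneg _) (abs_nonneg _) hn).1 (neg_injective hd)
  rw [← sign_mul_abs_self (funU Ψ F y), ← sign_mul_abs_self (funU Ψ F x), hys, habs]

end Flows

end LevelSetAffine

namespace LevelSetAffine

open scoped Topology Matrix ContDiff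

variable {n : ℕ} {Ψ : TopForm n} {F : Space n → ℝ} {Ω : Set (Space n)} {x : Space n}

/-! ### The equiaffine mean curvature -/

section MeanCurvature

theorem trace_eq_sum (T : Space n →ₗ[ℝ] Space n) :
    LinearMap.trace ℝ (Space n) T = ∑ i, T (stdVec i) i := by
  rw [LinearMap.trace_eq_matrix_trace ℝ (Pi.basisFun ℝ (Fin (n + 1))), Matrix.trace]
  refine Finset.sum_congr rfl fun i _ => ?_
  simp [stdVec]

theorem trace_smulRight_eq (f : Space n →ₗ[ℝ] ℝ) (v : Space n) :
    LinearMap.trace ℝ (Space n) (f.smulRight v) = f v := by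
  have h := clm_apply_eq_sum (LinearMap.toContinuousLinearMap f) v
  rw [trace_eq_sum]
  simpa [mul_comm] using h.symm

/-- The map `shapeAux` sends the whole space into the tangent space, so its full trace equals the
trace of its restriction $S$; the $\tau\otimes\xi$ part contributes $\tau(\xi)$. -/
theorem trace_shapeOperator {ξ : Space n → Space n} (h : fderiv ℝ F x (ξ x) ≠ 0) :
    LinearMap.trace ℝ (tangent F x) (shapeOperator F ξ x) =
      -LinearMap.trace ℝ (Space n) (fderiv ℝ ξ x).toLinearMap +
        (fderiv ℝ F x (ξ x))⁻¹ * fderiv ℝ F x (fderiv ℝ ξ x (ξ x)) := by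
  have h1 : shapeOperator F ξ x = (shapeAux F ξ x).restrict
      (p := tangent F x) (q := tangent F x) fun v _ => shapeAux_mem h v := by
    ext v : 1
    simp only [shapeOperator, dif_pos h]
    rfl
  rw [h1, LinearMap.trace_restrict_eq_of_forall_mem _ _ (shapeAux_mem h), shapeAux, map_add,
    map_neg, trace_smulRight_eq]
  rfl

/-- Symmetry of the third derivatives of $F$, obtained as symmetry of the second derivatives of
$F_k$: the hypothesis of Piola's identity. -/
theorem fderiv_hess_symm (hF : ContDiffAt ℝ ∞ F x) (i k l : Fin (n + 1)) :
    fderiv ℝ (fun y => hess F y k l) x (stdVec i) =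
      fderiv ℝ (fun y => hess F y k i) x (stdVec l) := by
  have hg := contDiffAt_grad hF k
  have hev : ∀ l, (fun y => hess F y k l) =ᶠ[𝓝 x]
      fun y => fderiv ℝ (fun z => grad F z k) y (stdVec l) := by
    intro l
    have : ∀ᶠ y in 𝓝 x, ContDiffAt ℝ (2 : ℕ) F y :=
      (hF.of_le (WithTop.coe_le_coe.2 (le_top : ((2 : ℕ) : ℕ∞) ≤ ⊤))).eventually (by simp)
    filter_upwards [this] with y hy
    have h1 : DifferentiableAt ℝ (fun z => fderiv ℝ F z) y :=
      (hy.fderiv_right (m := 1) (by norm_num)).differentiableAt one_ne_zero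
    have h2 : HasFDerivAt (fun z => grad F z k) _ y :=
      h1.hasFDerivAt.clm_apply (hasFDerivAt_const (stdVec k) y)
    rw [h2.fderiv]
    have h3 := hy.isSymmSndFDerivAt (by simp) (stdVec k) (stdVec l)
    simpa [hess] using h3
  have hd : ∀ i l, fderiv ℝ (fun y => hess F y k l) x (stdVec i) =
      fderiv ℝ (fun y => fderiv ℝ (fun z => grad F z k) y) x (stdVec i) (stdVec l) := by
    intro i l
    have h1 : HasFDerivAt (fun y => fderiv ℝ (fun z => grad F z k) y (stdVec l)) _ x :=
      ((hg.fderiv_right (m := ∞) (by simp)).differentiableAt (by simp)).hasFDerivAt.clm_apply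
        (hasFDerivAt_const (stdVec l) x)
    rw [(hev l).fderiv_eq, h1.fderiv]
    simp
  rw [hd, hd]
  exact hg.isSymmSndFDerivAt (by
    rw [minSmoothness_of_isRCLikeNormedField]
    exact WithTop.coe_le_coe.2 (le_top : (2 : ℕ∞) ≤ ⊤)) _ _

theorem fderiv_grad (hF : ContDiffAt ℝ ∞ F x) (p : Fin (n + 1)) (v : Space n) :
    fderiv ℝ (fun y => grad F y p) x v =
      fderiv ℝ (fun y => fderiv ℝ F y) x v (stdVec p) := by
  have h2 : HasFDerivAt (fun z => grad F z p) _ x :=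
    ((hF.fderiv_right (m := ∞) (by simp)).differentiableAt (by simp)).hasFDerivAt.clm_apply
      (hasFDerivAt_const (stdVec p) x)
  rw [h2.fderiv]
  simp

/-- The divergence of `N` is `(n + 1) H(F)`. -/
theorem trace_fderiv_fieldN (Ψ : TopForm n) (hF : ContDiffAt ℝ ∞ F x) :
    LinearMap.trace ℝ (Space n) (fderiv ℝ (fieldN Ψ F) x).toLinearMap =
      ((n : ℝ) + 1) * hessDet Ψ F x := by
  have hadj : ∀ i p, DifferentiableAt ℝ (fun y => (hess F y).adjugate i p) x := fun i p =>
    (contDiffAt_adjugate (contDiffAt_hess hF) i p).differentiableAt (by simp)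
  have hgrad : ∀ p, DifferentiableAt ℝ (fun y => grad F y p) x := fun p =>
    (contDiffAt_grad hF p).differentiableAt (by simp)
  have hN : ∀ i, fderiv ℝ (fieldN Ψ F) x (stdVec i) i = (volCoeff Ψ ^ 2)⁻¹ *
      ∑ p, (fderiv ℝ (fun y => (hess F y).adjugate i p) x (stdVec i) * grad F x p +
        (hess F x).adjugate i p * hess F x p i) := by
    intro i
    have h1 : HasFDerivAt (fun y => (volCoeff Ψ ^ 2)⁻¹ *
        ∑ p, (hess F y).adjugate i p * grad F y p) _ x :=
      (HasFDerivAt.fun_sum (u := Finset.univ) fun p _ =>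
        (hadj i p).hasFDerivAt.mul (hgrad p).hasFDerivAt).const_mul _
    have h2 : (fun y => fieldN Ψ F y i) = fun y => (volCoeff Ψ ^ 2)⁻¹ *
        ∑ p, (hess F y).adjugate i p * grad F y p := by
      ext y
      rw [fieldN, adjTensor, Matrix.smul_mulVec]
      rfl
    have h3 := hasFDerivAt_pi'.1
      ((contDiffAt_fieldN' Ψ hF).differentiableAt (by simp)).hasFDerivAt i
    rw [h2] at h3
    have h4 := congrArg (fun T => T (stdVec i)) (h3.unique h1)
    simp only [ContinuousLinearMap.comp_apply, ContinuousLinearMap.proj_apply, smul_apply,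
      sum_apply, add_apply, smul_eq_mul, fderiv_grad hF] at h4
    rw [h4]
    congr 1
    refine Finset.sum_congr rfl fun p _ => ?_
    have h5 : fderiv ℝ (fun y => fderiv ℝ F y) x (stdVec i) (stdVec p) = hess F x p i :=
      congrFun (congrFun (hess_transpose hF) p) i
    rw [h5]
    ring
  rw [trace_eq_sum]
  have hpiola := sum_fderiv_adjugate_eq_zero (A := hess F) (x := x) (e := stdVec)
    (fun k l => (contDiffAt_hess hF k l).of_le (by simp)) (fderiv_hess_symm hF)
  have htr : ∑ i, ∑ p, (hess F x).adjugate i p * hess F x p i =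
      ((n : ℝ) + 1) * (hess F x).det := by
    have h1 := congrArg Matrix.trace (Matrix.adjugate_mul (hess F x))
    rw [Matrix.trace_smul, Matrix.trace_one, Fintype.card_fin, smul_eq_mul] at h1
    simp only [Matrix.trace, Matrix.diag_apply, Matrix.mul_apply] at h1
    rw [h1]
    push_cast
    ring
  have hz : ∑ i, ∑ p, fderiv ℝ (fun y => (hess F y).adjugate i p) x (stdVec i) * grad F x p
      = 0 := by
    rw [Finset.sum_comm]
    refine Finset.sum_eq_zero fun p _ => ?_
    rw [← Finset.sum_mul, hpiola, zero_mul]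
  simp only [ContinuousLinearMap.coe_coe, hN]
  rw [← Finset.mul_sum]
  simp only [Finset.sum_add_distrib]
  rw [hz, htr, hessDet]
  ring

/-- Differentiate $U=N^pF_p$ along $N$ and use $F_{pq}N^q=HF_p$. This expresses $dF(\hat\nabla_NN)$
through $\mu(N)$ and $H$. -/
theorem fderiv_funU (Ψ : TopForm n) (hF : ContDiffAt ℝ ∞ F x) :
    fderiv ℝ (funU Ψ F) x (fieldN Ψ F x) = hessDet Ψ F x * funU Ψ F x +
      fderiv ℝ F x (fderiv ℝ (fieldN Ψ F) x (fieldN Ψ F x)) := by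
  have hN := hasFDerivAt_pi'.1
    ((contDiffAt_fieldN' Ψ hF).differentiableAt (by simp)).hasFDerivAt
  have h1 : HasFDerivAt (funU Ψ F) _ x := HasFDerivAt.fun_sum (u := Finset.univ) fun p _ =>
    (hN p).mul ((contDiffAt_grad hF p).differentiableAt (by simp)).hasFDerivAt
  rw [h1.fderiv]
  simp only [ContinuousLinearMap.comp_apply, ContinuousLinearMap.proj_apply, smul_apply,
      sum_apply, add_apply, smul_eq_mul, fderiv_grad hF, Finset.sum_add_distrib]
  rw [fderiv_apply_eq_dotProduct F x (fderiv ℝ (fieldN Ψ F) x (fieldN Ψ F x))]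
  congr 1
  · have h2 : ∀ p, fderiv ℝ (fun y => fderiv ℝ F y) x (fieldN Ψ F x) (stdVec p) =
        (hess F x *ᵥ fieldN Ψ F x) p := by
      intro p
      have h3 := clm_apply_eq_sum ((fderiv ℝ (fun y => fderiv ℝ F y) x).flip (stdVec p))
        (fieldN Ψ F x)
      rw [ContinuousLinearMap.flip_apply] at h3
      rw [h3, Matrix.mulVec, dotProduct]
      refine Finset.sum_congr rfl fun j _ => ?_
      rw [mul_comm]
      congr 1
      exact congrFun (congrFun (hess_transpose hF) p) j
    simp only [h2, hess_mulVec_fieldN, Pi.smul_apply, smul_eq_mul]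
    rw [funU, dotProduct, Finset.mul_sum]
    exact Finset.sum_congr rfl fun j _ => by ring
  · exact Finset.sum_congr rfl fun j _ => mul_comm _ _

theorem eqMeanCurvature_formula (hΨ : Ψ ≠ 0) (hΩ : IsOpen Ω)
    (hF : ∀ x ∈ Ω, ContDiffAt ℝ ∞ F x) (hU : ∀ x ∈ Ω, funU Ψ F x ≠ 0)
    (hZ : ∀ x ∈ Ω, fieldZ Ψ F x = 0) (hx : x ∈ Ω) :
    (n : ℝ) * eqMeanCurvature Ψ F x =
        ((n : ℝ) + 2) * (Real.sign (funU Ψ F x) *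
          |funU Ψ F x| ^ (-(((n : ℝ) + 1) / ((n : ℝ) + 2)))) *
          (hessDet Ψ F x - formMu Ψ F x (fieldN Ψ F x)) := by
  have hFx := hF x hx
  have hUx := hU x hx
  have hn2 : ((n : ℝ) + 2) ≠ 0 := by positivity
  obtain ⟨c, hc⟩ : ∃ c, c = -(Real.sign (funU Ψ F x) *
      |funU Ψ F x| ^ (-(((n : ℝ) + 1) / ((n : ℝ) + 2)))) := ⟨_, rfl⟩
  have hc0 : c ≠ 0 := hc ▸ normalCoeff_ne_zero hUx
  have hν : eqNormal Ψ F x = c • fieldN Ψ F x := by rw [hc, eqNormal, hZ x hx, add_zero]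
  -- With $Z=0$ near $x$ and the sign of $U$ locally constant, $\nu=cN$ with $c$ a multiple of
  -- $|U|^{-(n+1)/(n+2)}$; hence $dc=-(n+1)c\,\mu$.
  have hdν : HasFDerivAt (eqNormal Ψ F) (c • fderiv ℝ (fieldN Ψ F) x +
      ((-((n : ℝ) + 1) * c) • formMu Ψ F x).smulRight (fieldN Ψ F x)) x := by
    have h1 := ((hasFDerivAt_abs_funU_rpow hFx hUx (-(((n : ℝ) + 1) / ((n : ℝ) + 2)))).const_mul
      (Real.sign (funU Ψ F x))).neg
    have h2 := h1.smul ((contDiffAt_fieldN' Ψ hFx).differentiableAt (by simp)).hasFDerivAt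
    have h3 : eqNormal Ψ F =ᶠ[𝓝 x] fun y => (-(Real.sign (funU Ψ F x) *
        |funU Ψ F y| ^ (-(((n : ℝ) + 1) / ((n : ℝ) + 2))))) • fieldN Ψ F y := by
      filter_upwards [eventually_sign_funU hFx hUx, hΩ.mem_nhds hx] with y hy hyΩ
      rw [eqNormal, hy, hZ y hyΩ, add_zero]
    refine (h2.congr_of_eventuallyEq h3).congr_fderiv ?_
    ext v i
    simp only [Pi.neg_apply, add_apply, smul_apply, neg_apply, smul_eq_mul,
      ContinuousLinearMap.smulRight_apply, Pi.add_apply, Pi.smul_apply, hc]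
    field_simp
  have hdF : fderiv ℝ F x (eqNormal Ψ F x) = c * funU Ψ F x := by
    rw [hν, map_smul, smul_eq_mul]
    congr 1
    exact fderiv_apply_eq_dotProduct _ _ _
  have hdF0 : fderiv ℝ F x (eqNormal Ψ F x) ≠ 0 := by
    rw [hdF]
    exact mul_ne_zero hc0 hUx
  have htr : LinearMap.trace ℝ (tangent F x) (shapeOperator F (eqNormal Ψ F) x) =
      ((n : ℝ) + 2) * (-c) * (hessDet Ψ F x - formMu Ψ F x (fieldN Ψ F x)) := by
    rw [trace_shapeOperator hdF0, hdν.fderiv]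
    have h1 : LinearMap.trace ℝ (Space n) (c • fderiv ℝ (fieldN Ψ F) x +
        ((-((n : ℝ) + 1) * c) • formMu Ψ F x).smulRight (fieldN Ψ F x)).toLinearMap =
        c * (((n : ℝ) + 1) * hessDet Ψ F x) +
          -((n : ℝ) + 1) * c * formMu Ψ F x (fieldN Ψ F x) := by
      have h2 : (c • fderiv ℝ (fieldN Ψ F) x +
          ((-((n : ℝ) + 1) * c) • formMu Ψ F x).smulRight (fieldN Ψ F x)).toLinearMap =
          c • (fderiv ℝ (fieldN Ψ F) x).toLinearMap +
          ((-((n : ℝ) + 1) * c) • (formMu Ψ F x).toLinearMap).smulRight (fieldN Ψ F x) := by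
        ext
        rfl
      rw [h2, map_add, map_smul, trace_fderiv_fieldN Ψ hFx, trace_smulRight_eq]
      rfl
    have hμ := formMu_apply hFx hUx (fieldN Ψ F x)
    have hUN := fderiv_funU Ψ hFx
    have hFN : fderiv ℝ F x (fieldN Ψ F x) = funU Ψ F x := fderiv_apply_eq_dotProduct _ _ _
    rw [h1, hdF, hν]
    simp only [add_apply, smul_apply, ContinuousLinearMap.smulRight_apply, map_add, map_smul,
      smul_eq_mul, hFN]
    have hFNN : fderiv ℝ F x (fderiv ℝ (fieldN Ψ F) x (fieldN Ψ F x)) =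
        funU Ψ F x * (((n : ℝ) + 2) * formMu Ψ F x (fieldN Ψ F x) - hessDet Ψ F x) := by
      rw [hμ]
      field_simp
      linarith
    rw [hFNN]
    field_simp
    ring
  rw [eqMeanCurvature, meanCurvature, htr, hc, neg_neg]
  -- For $n=0$ the factor $n\cdot n^{-1}$ is $0$, not $1$; the tangent space is then zero, so the
  -- trace, and with it the right-hand side, vanishes.
  rcases Nat.eq_zero_or_pos n with rfl | hpos
  · have h0 : LinearMap.trace ℝ (tangent F x) (shapeOperator F (eqNormal Ψ F) x) = 0 := by
      have hsub : tangent F x = ⊥ := by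
        rw [Submodule.eq_bot_iff]
        intro v hv
        have hv' : fderiv ℝ F x v = 0 := hv
        obtain ⟨w, hw⟩ := DFunLike.ne_iff.1 (grad_ne_zero hUx)
        rw [fderiv_apply_eq_dotProduct] at hv' hw
        rw [dotProduct, Finset.univ_unique (α := Fin 1), Finset.sum_singleton] at hv' hw
        ext i
        rw [Subsingleton.elim (α := Fin 1) i default]
        exact (mul_eq_zero.1 hv').resolve_right fun h => hw (by rw [h, mul_zero]; rfl)
      have hss : Subsingleton (tangent F x) := by
        rw [hsub]
        infer_instance
      rw [Subsingleton.elim (shapeOperator F (eqNormal Ψ F) x) 0, map_zero]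
    rw [h0] at htr
    rw [hc, neg_neg] at htr
    rw [← htr]
    simp
  · have : (n : ℝ) ≠ 0 := by positivity
    field_simp

end MeanCurvature

/-! ### The potential of the conormal -/

section Potential

theorem exists_potential (hΩ : IsOpen Ω) (hF : ∀ x ∈ Ω, ContDiffAt ℝ ∞ F x)
    (hU : ∀ x ∈ Ω, funU Ψ F x ≠ 0) (hcl : IsClosedOn (conormal Ψ F) Ω)
    (hsc : IsSimplyConnected Ω) :
    ∃ G : Space n → ℝ, ContDiffOn ℝ ∞ G Ω ∧ ∀ x ∈ Ω, fderiv ℝ G x = -conormal Ψ F x := by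
  have hc : ∀ x ∈ Ω, ContDiffAt ℝ ∞ (conormal Ψ F) x := fun x hx =>
    contDiffAt_conormal (hF x hx) (hU x hx)
  have hd : ∀ x ∈ Ω, DifferentiableAt ℝ (conormal Ψ F) x := fun x hx =>
    (hc x hx).differentiableAt (by simp)
  rw [isClosedOn_iff hd] at hcl
  obtain ⟨G, hG⟩ := exists_hasFDerivAt_of_isSimplyConnected hΩ hsc
    (θ := fun x => -conormal Ψ F x) (fun x hx => (hd x hx).neg.differentiableWithinAt)
    (fun x hx u v => by
      rw [fderiv_fun_neg]
      simp only [neg_apply]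
      rw [hcl x hx])
  refine ⟨G, ?_, fun x hx => (hG x hx).fderiv⟩
  rw [contDiffOn_infty_iff_fderiv_of_isOpen hΩ]
  refine ⟨fun x hx => (hG x hx).differentiableAt.differentiableWithinAt, fun x hx => ?_⟩
  exact ((hc x hx).neg.contDiffWithinAt).congr (fun y hy => (hG y hy).fderiv) (hG x hx).fderiv

theorem funU_potential (hΨ : Ψ ≠ 0) (hΩ : IsOpen Ω) (hF : ∀ x ∈ Ω, ContDiffAt ℝ ∞ F x)
    (hU : ∀ x ∈ Ω, funU Ψ F x ≠ 0) (hZ : ∀ x ∈ Ω, fieldZ Ψ F x = 0) {G : Space n → ℝ}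
    (hG : ∀ x ∈ Ω, fderiv ℝ G x = -conormal Ψ F x) (hx : x ∈ Ω) :
    funU Ψ G x = Real.sign (funU Ψ F x) := by
  have hFx := hF x hx
  have hUx := hU x hx
  have hn2 : ((n : ℝ) + 2) ≠ 0 := by positivity
  have hdG : ∀ y ∈ Ω, fderiv ℝ G y =
      (|funU Ψ F y| ^ (-(1 / ((n : ℝ) + 2)))) • fderiv ℝ F y := by
    intro y hy
    rw [hG y hy, conormal]
    ext v
    simp
  obtain ⟨a, ha⟩ : ∃ a, a = |funU Ψ F x| ^ (-(1 / ((n : ℝ) + 2))) := ⟨_, rfl⟩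
  obtain ⟨l, hl⟩ : ∃ l, l = (funU Ψ F x)⁻¹ * formMu Ψ F x (fieldN Ψ F x) := ⟨_, rfl⟩
  have hgrad : grad G x = a • grad F x := by
    ext i
    simp only [grad, hdG x hx, ← ha]
    rfl
  -- From $dG=a\,dF$ with $a=|U|^{-1/(n+2)}$ and $da=-a\mu$, where $\mu=l\,dF$ because $Z=0$.
  have hhess : hess G x = a • (hess F x + (-l) • Matrix.vecMulVec (grad F x) (grad F x)) := by
    have h1 := (hasFDerivAt_abs_funU_rpow hFx hUx (-(1 / ((n : ℝ) + 2)))).smul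
      ((hFx.fderiv_right (m := ∞) (by simp)).differentiableAt (by simp)).hasFDerivAt
    have h2 : (fun y => fderiv ℝ G y) =ᶠ[𝓝 x]
        fun y => (|funU Ψ F y| ^ (-(1 / ((n : ℝ) + 2)))) • fderiv ℝ F y := by
      filter_upwards [hΩ.mem_nhds hx] with y hy using hdG y hy
    have h3 := (h1.congr_of_eventuallyEq h2).fderiv
    ext i j
    have h4 : formMu Ψ F x (stdVec i) = l * grad F x i := by
      rw [hl]
      exact (fieldZ_eq_zero_iff hΨ hUx).1 (hZ x hx) (stdVec i)
    rw [hess, Matrix.of_apply, h3]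
    simp only [add_apply, smul_apply, ContinuousLinearMap.smulRight_apply, smul_eq_mul, h4,
      Matrix.smul_apply, Matrix.add_apply, Matrix.vecMulVec_apply, ← ha, hess, Matrix.of_apply]
    rw [show fderiv ℝ F x (stdVec j) = grad F x j from rfl]
    field_simp
  have hκ := volCoeff_ne_zero hΨ
  -- The adjugate contributes $a^n$ and the two gradients $a^2$; the rank-one term is invisible to
  -- $dF^{T}\mathrm{adj}\,dF$.
  have hUG : funU Ψ G x = a ^ (n + 2) * funU Ψ F x := by
    have h1 := dotProduct_adjugate_grad (F := G) (x := x) hΨ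
    rw [hgrad, hhess, Matrix.adjugate_smul, Fintype.card_fin, Nat.add_sub_cancel,
      Matrix.smul_mulVec, Matrix.mulVec_smul, smul_dotProduct, dotProduct_smul, dotProduct_smul,
      dotProduct_adjugate_add_smul_vecMulVec, dotProduct_adjugate_grad hΨ] at h1
    simp only [smul_eq_mul] at h1
    refine mul_left_cancel₀ (pow_ne_zero 2 hκ) ?_
    rw [← h1]
    ring
  have hpow : a ^ (n + 2) = |funU Ψ F x|⁻¹ := by
    rw [ha, ← Real.rpow_natCast, ← Real.rpow_mul (abs_nonneg _), ← Real.rpow_neg_one]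
    congr 1
    push_cast
    field_simp
  have hsign := sign_mul_abs_self (funU Ψ F x)
  rw [hUG, hpow]
  nth_rewrite 2 [← hsign]
  rw [mul_left_comm, inv_mul_cancel₀ (abs_ne_zero.2 hUx), mul_one]

end Potential

end LevelSetAffine

/-! ### The equivalences and their consequences -/

theorem lemma2p13 (n : ℕ) (Ψ : TopForm n) (hΨ : Ψ ≠ 0)
    (D : Set (Space n)) (hD : IsOpen D)
    (F : Space n → ℝ) (hF : ContDiffOn ℝ (⊤ : ℕ∞) F D)
    (p : Space n) (hpD : p ∈ D) (hp : funU Ψ F p ≠ 0)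
    (Ω : Set (Space n)) (hΩ : Ω = connectedComponentIn {x | x ∈ D ∧ funU Ψ F x ≠ 0} p) :
    List.TFAE [
      ∀ r ∈ F '' Ω, IsLocallyConstant (fun x : levelSet F Ω r => funU Ψ F (x : Space n)),
      IsClosedOn (conormal Ψ F) Ω,
      ∀ x ∈ Ω, WedgeFormsZero (formMu Ψ F x) (conormal Ψ F x),
      FlowPreservesLevelSets (eqNormal Ψ F) F Ω,
      FlowPreservesForm (eqNormal Ψ F) (conormal Ψ F) Ω,
      ∀ x ∈ Ω, WedgeVectorsZero (eqNormal Ψ F x) (fieldN Ψ F x),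
      ∀ x ∈ Ω, eqNormal Ψ F x =
        (-(Real.sign (funU Ψ F x) * |funU Ψ F x| ^ (-(((n : ℝ) + 1) / ((n : ℝ) + 2))))) •
          fieldN Ψ F x] ∧
    ((∀ r ∈ F '' Ω, IsLocallyConstant (fun x : levelSet F Ω r => funU Ψ F (x : Space n))) →
      (∀ x ∈ Ω, (n : ℝ) * eqMeanCurvature Ψ F x =
        ((n : ℝ) + 2) * (Real.sign (funU Ψ F x) *
          |funU Ψ F x| ^ (-(((n : ℝ) + 1) / ((n : ℝ) + 2)))) *
          (hessDet Ψ F x - formMu Ψ F x (fieldN Ψ F x))) ∧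
      (IsSimplyConnected Ω →
        (∃ G : Space n → ℝ, ContDiffOn ℝ (⊤ : ℕ∞) G Ω ∧
          ∀ x ∈ Ω, fderiv ℝ G x = -conormal Ψ F x) ∧
        ∀ G : Space n → ℝ, ContDiffOn ℝ (⊤ : ℕ∞) G Ω →
          (∀ x ∈ Ω, fderiv ℝ G x = -conormal Ψ F x) →
          (∀ r ∈ F '' Ω, IsLocallyConstant (fun x : levelSet F Ω r => G (x : Space n))) ∧
          (∀ x ∈ Ω, funU Ψ G x = Real.sign (funU Ψ F x)) ∧
          (∀ x ∈ Ω, |funU Ψ G x| = 1))) := by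
  have hFat : ∀ x ∈ D, ContDiffAt ℝ (⊤ : ℕ∞) F x := fun x hx => hF.contDiffAt (hD.mem_nhds hx)
  have hopen : IsOpen {x | x ∈ D ∧ funU Ψ F x ≠ 0} := by
    refine isOpen_iff_mem_nhds.2 fun x hx => ?_
    filter_upwards [hD.mem_nhds hx.1,
      (contDiffAt_funU Ψ (hFat x hx.1)).continuousAt.eventually_ne hx.2] with y h1 h2
    exact ⟨h1, h2⟩
  have hΩo : IsOpen Ω := hΩ ▸ hopen.connectedComponentIn
  have hsub : Ω ⊆ {x | x ∈ D ∧ funU Ψ F x ≠ 0} := hΩ ▸ connectedComponentIn_subset _ _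
  have hF' : ∀ x ∈ Ω, ContDiffAt ℝ (⊤ : ℕ∞) F x := fun x hx => hFat x (hsub hx).1
  have hU : ∀ x ∈ Ω, funU Ψ F x ≠ 0 := fun x hx => (hsub hx).2
  have h13 := forall_isLocallyConstant_funU_iff (Ψ := Ψ) hΩo hF' hU
  have h23 := isClosedOn_conormal_iff hF' hU
  have h3Z : (∀ x ∈ Ω, WedgeFormsZero (formMu Ψ F x) (conormal Ψ F x)) ↔
      ∀ x ∈ Ω, fieldZ Ψ F x = 0 :=
    forall₂_congr fun x hx => wedgeFormsZero_iff hΨ (hU x hx)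
  refine ⟨?_, fun h1 => ?_⟩
  · tfae_have 1 ↔ 3 := h13
    tfae_have 2 ↔ 3 := h23
    tfae_have 3 ↔ 6 := h3Z.trans
      (forall₂_congr fun x hx => (wedgeVectorsZero_iff hΨ (hF' x hx) (hU x hx)).symm)
    tfae_have 3 ↔ 7 := h3Z.trans (forall₂_congr fun x hx => (eqNormal_eq_iff (hU x hx)).symm)
    tfae_have 2 → 5 := flowPreservesForm_of_isClosedOn hΩo
      (fun x hx => (contDiffAt_conormal (hF' x hx) (hU x hx)).differentiableAt (by simp))
      (fun x hx => conormal_eqNormal hΨ (hF' x hx) (hU x hx))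
    tfae_have 5 → 4 := flowPreservesLevelSets_of_flowPreservesForm hF' hU
    tfae_have 4 → 1 := fun h => (forall_isLocallyConstant_iff hΩo _).2
      (eventually_funU_eq_of_flowPreservesLevelSets hΨ hΩo hF' hU h)
    tfae_finish
  · have h3 := h13.1 h1
    have hZ := h3Z.1 h3
    refine ⟨fun x hx => eqMeanCurvature_formula hΨ hΩo hF' hU hZ hx, fun hsc =>
      ⟨exists_potential hΩo hF' hU (h23.2 h3) hsc, fun G hG hdG => ?_⟩⟩
    have hUG : ∀ x ∈ Ω, funU Ψ G x = Real.sign (funU Ψ F x) := fun x hx =>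
      funU_potential hΨ hΩo hF' hU hZ hdG hx
    refine ⟨(forall_isLocallyConstant_iff hΩo G).2 fun x hx => ?_, hUG, fun x hx => ?_⟩
    · refine eventually_eq_of_fderiv_ker ((hF' x hx).of_le (by simp)) (grad_ne_zero (hU x hx)) ?_
      filter_upwards [hΩo.mem_nhds hx] with y hy
      refine ⟨(hF' y hy).differentiableAt (by simp),
        (hG.contDiffAt (hΩo.mem_nhds hy)).differentiableAt (by simp), fun v hv => ?_⟩
      rw [hdG y hy, neg_apply, (conormal_eq_zero_iff (hU y hy) v).2 hv, neg_zero]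
    · rw [hUG x hx]
      rcases Real.sign_apply_eq_of_ne_zero _ (hU x hx) with h | h <;> rw [h] <;> simp
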